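/- **Setting.** Let $f(x)=\sum_{i=1}^k f_i(x_i)$ and $g(z)=\sum_{j=1}^{\ell} g_j(z_j)$ with $x=(x_1,\dots,x_k)\in\mathbb R^{m}$, $z=(z_1,\dots,z_\ell)\in\mathbb R^{n}$, let $E\in\mathbb R^{p\times m}$, $F\in\mathbb R^{p\times n}$, $q\in\mathbb R^p$, and consider the problem of minimizing $f(x)+g(z)$ subject to $Ex+Fz-q=0$. For $\mu>0$ let $\operatorname{prox}_{\mu g}(v)=\arg\min_w\, g(w)+\frac1{2\mu}\|w-v\|^2$, let $M_{\mu g}(v)=g(\operatorname{prox}_{\mu g}(v))+\frac1{2\mu}\|\operatorname{prox}_{\mu g}(v)-v\|^2$ be the Moreau envelope, and let $$\mathcal L_\mu(x,z;y,\lambda)=f(x)+M_{\mu g}(z+\mu y)+\tfrac1{2\mu}\|Ex+Fz-q+\mu\lambda\|^2-\tfrac\mu2\|y\|^2-\tfrac\mu2\|\lambda\|^2$$ be the proximal augmented Lagrangian. The primal-dual gradient flow dynamics for the state $\psi=(x,z,y,\lambda)$ are $$\dot x=-\nabla_x\mathcal L_\mu,\quad \dot z=-\nabla_z\mathcal L_\mu,\quad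 \dot y=\alpha\nabla_y\mathcal L_\mu,\quad \dot\lambda=\alpha\nabla_\lambda\mathcal L_\mu,\qquad \alpha>0,$$ and $\Psi_\star$ denotes their set of equilibrium points. **Assumptions.** (1) Each $f_i$ is convex and differentiable, $\nabla f$ is $L_f$-Lipschitz, each $g_j$ is proper, closed and convex, and there is $(x,z)$ with $Ex+Fz=q$ and $z$ in the relative interior of $\operatorname{dom} g$. (2) Let $I$ and $J$ be the sets of indices for which $f_i$, respectively $g_j$, is not strongly convex. The matrix $[E_I\ F_J]$, formed by the columns of $E$ and $F$ that belong to the blocks in $I$ and $J$, has full column rank. (3) $\mathcal R(F)\subseteq\mathcal R(E)$. Let $m_f>0$ and $m_g>0$ be strong convexity moduli common to the blocks $f_i$, $i\notin I$, and $g_j$, $j\notin J$, respectively ($m_f=0$ or $m_g=0$ is allowed if there are no such blocks), and assume $\mu m_g\le 1$. **Theorem (GES).** There is $m_{xz}>0$, depending only on $E,F,\mu,L_f,I,J,m_f,m_g$, such that $\mathcal L_\mu$ is strongly convex with modulus $m_{xz}$ in $(x,z)$ for all $(y,\lambda)$. For any $m_{xz}>0$ with this strong convexity property, let $$\bar\alpha_2=\frac{m_{xz}^2}{\sigma_{\max}^2([E\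 F])+4},\qquad \alpha\in(0,\bar\alpha_2).$$ Then there are $M_2,\rho_2>0$, depending only on $E,F,\mu,\alpha,L_f,m_{xz},I,J,m_f,m_g$ (in particular neither on the initial time nor on the initial condition), such that the following holds. The set $\Psi_\star$ is a nonempty affine set, and every solution $\psi:[t_0,\infty)\to\mathbb R^{m+2n+p}$ of the dynamics converges, as $t\to\infty$, to a point $\psi_\star\in\Psi_\star$ which is the orthogonal projection of $\psi(t_0)$ onto $\Psi_\star$, i.e. $\psi_\star=\arg\min_{\phi\in\Psi_\star}\|\psi(t_0)-\phi\|$, and $$\|\psi(t)-\psi_\star\|^2\le M_2\,\|\psi(t_0)-\psi_\star\|^2\,e^{-\rho_2(t-t_0)}\qquad\text{for all } t\ge t_0 .$$ -/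

import Mathlib

namespace PDFlow

noncomputable section

/-! ### Block vectors and matrices -/

/-- The index set of the coordinates of a block vector with blocks of sizes `d 0, …, d (r-1)`. -/
abbrev BlockIndex {r : ℕ} (d : Fin r → ℕ) : Type := Σ i : Fin r, Fin (d i)

/-- The space `ℝ^{d 0} × ⋯ × ℝ^{d (r-1)}` of block vectors, with the Euclidean norm. -/
abbrev BlockVec {r : ℕ} (d : Fin r → ℕ) : Type := EuclideanSpace ℝ (BlockIndex d)

/-- The `i`-th block of a block vector. -/
def block {r : ℕ} {d : Fin r → ℕ} (x : BlockVec d) (i : Fin r) :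
    EuclideanSpace ℝ (Fin (d i)) :=
  WithLp.toLp 2 (fun a => x ⟨i, a⟩)

/-- A matrix with `p` rows whose columns are grouped into blocks of sizes `d 0, …, d (r-1)`. -/
abbrev BlockMatrix (p : ℕ) {r : ℕ} (d : Fin r → ℕ) : Type :=
  Matrix (Fin p) (BlockIndex d) ℝ

/-- The submatrix formed by the columns that belong to the blocks indexed by `I`. -/
def colBlocks {p r : ℕ} {d : Fin r → ℕ} (A : BlockMatrix p d) (I : Set (Fin r)) :
    Matrix (Fin p) {c : BlockIndex d // c.1 ∈ I} ℝ :=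
  A.submatrix id (fun c => c.1)

/-- `A` has full column rank: its columns are linearly independent. -/
def FullColumnRank {ι κ : Type} (A : Matrix ι κ ℝ) : Prop :=
  LinearIndependent ℝ A.col

/-- The largest singular value of `A`, i.e. its operator norm for the Euclidean norms. -/
def maxSingularValue {ι κ : Type} [Fintype ι] [Fintype κ] [DecidableEq κ]
    (A : Matrix ι κ ℝ) : ℝ :=
  ‖(Matrix.toEuclideanLin A).toContinuousLinearMap‖

/-! ### Extended-valued convex functions -/

section ConvexFunctions

variable {V : Type} [NormedAddCommGroup V] [InnerProductSpace ℝ V]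

/-- The effective domain of an extended-valued function. -/
def effDom (g : V → EReal) : Set V := {z | g z < ⊤}

/-- Proper closed convex functions `V → ℝ ∪ {+∞}`; convexity is convexity of the epigraph. -/
structure IsProperClosedConvex (g : V → EReal) : Prop where
  ne_bot : ∀ z, g z ≠ ⊥
  nonempty_effDom : (effDom g).Nonempty
  lowerSemicontinuous : LowerSemicontinuous g
  convex_epigraph : Convex ℝ {w : V × ℝ | g w.1 ≤ (w.2 : EReal)}

/-- Strong convexity with modulus `c` of an extended-valued function that never takes the value
`-∞`: `g (a u + b v) ≤ a g(u) + b g(v) - (c/2) a b ‖u - v‖²` for all `u, v` in the effective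
domain and all `a, b ≥ 0` with `a + b = 1`. -/
def ExtStrongConvex (c : ℝ) (g : V → EReal) : Prop :=
  ∀ ⦃u : V⦄, u ∈ effDom g → ∀ ⦃v : V⦄, v ∈ effDom g → ∀ ⦃a b : ℝ⦄, 0 ≤ a → 0 ≤ b → a + b = 1 →
    g (a • u + b • v) ≤
      ((a * (g u).toReal + b * (g v).toReal - c / 2 * (a * b) * ‖u - v‖ ^ 2 : ℝ) : EReal)

/-- `w` minimizes `g(w) + (1/(2μ)) ‖w - v‖²`. -/
def IsProx (μ : ℝ) (g : V → EReal) (v w : V) : Prop :=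
  ∀ u : V, g w + ((1 / (2 * μ) * ‖w - v‖ ^ 2 : ℝ) : EReal) ≤
    g u + ((1 / (2 * μ) * ‖u - v‖ ^ 2 : ℝ) : EReal)

/-- The proximal operator of `μ g`: the minimizer of `g(w) + (1/(2μ)) ‖w - v‖²`. -/
def prox (μ : ℝ) (g : V → EReal) (v : V) : V :=
  Classical.epsilon (IsProx μ g v)

/-- The Moreau envelope `g(prox_{μg}(v)) + (1/(2μ)) ‖prox_{μg}(v) - v‖²`. -/
def moreau (μ : ℝ) (g : V → EReal) (v : V) : ℝ :=
  (g (prox μ g v)).toReal + 1 / (2 * μ) * ‖prox μ g v - v‖ ^ 2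

end ConvexFunctions

/-! ### The composite problem

minimize `∑ i, f i (x_i) + ∑ j, g j (z_j)` subject to `E x + F z - q = 0`. -/

/-- The smooth part `f(x) = ∑ i, f_i(x_i)` of the objective. -/
def smoothPart {k : ℕ} {m : Fin k → ℕ} (f : ∀ i, EuclideanSpace ℝ (Fin (m i)) → ℝ)
    (x : BlockVec m) : ℝ :=
  ∑ i, f i (block x i)

/-- The nonsmooth part `g(z) = ∑ j, g_j(z_j)` of the objective. -/
def nonsmoothPart {l : ℕ} {n : Fin l → ℕ} (g : ∀ j, EuclideanSpace ℝ (Fin (n j)) → EReal)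
    (z : BlockVec n) : EReal :=
  ∑ j, g j (block z j)

/-- The residual `E x + F z - q` of the linear constraint. -/
def residual {k l p : ℕ} {m : Fin k → ℕ} {n : Fin l → ℕ}
    (E : BlockMatrix p m) (F : BlockMatrix p n) (q : EuclideanSpace ℝ (Fin p))
    (x : BlockVec m) (z : BlockVec n) : EuclideanSpace ℝ (Fin p) :=
  Matrix.toEuclideanLin E x + Matrix.toEuclideanLin F z - q

/-- The convexity assumptions and the constraint qualification: every `f_i` is convex and
differentiable, `∇f` is `L`-Lipschitz, every `g_j` is proper, closed and convex, and there is a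
feasible point `(x, z)` with `z` in the relative interior of the effective domain of `g`. -/
structure StandingAssumptions {k l p : ℕ} {m : Fin k → ℕ} {n : Fin l → ℕ}
    (E : BlockMatrix p m) (F : BlockMatrix p n) (q : EuclideanSpace ℝ (Fin p))
    (f : ∀ i, EuclideanSpace ℝ (Fin (m i)) → ℝ)
    (g : ∀ j, EuclideanSpace ℝ (Fin (n j)) → EReal) (L : NNReal) : Prop where
  convex_f : ∀ i, ConvexOn ℝ Set.univ (f i)
  differentiable_f : ∀ i, Differentiable ℝ (f i)
  lipschitz_grad_f : LipschitzWith L (gradient (smoothPart f))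
  closed_convex_g : ∀ j, IsProperClosedConvex (g j)
  qualification : ∃ (x : BlockVec m) (z : BlockVec n),
    z ∈ intrinsicInterior ℝ (effDom (nonsmoothPart g)) ∧ residual E F q x z = 0

/-- `I` and `J` are exactly the sets of indices of the blocks `f_i`, `g_j` that are not strongly
convex, and `mf > 0`, `mg > 0` are common strong convexity moduli of the remaining blocks
(`mf`, respectively `mg`, is unconstrained if there is no strongly convex block of that kind). -/
structure StrongConvexityPattern {k l : ℕ} {m : Fin k → ℕ} {n : Fin l → ℕ}
    (f : ∀ i, EuclideanSpace ℝ (Fin (m i)) → ℝ)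
    (g : ∀ j, EuclideanSpace ℝ (Fin (n j)) → EReal)
    (I : Set (Fin k)) (J : Set (Fin l)) (mf mg : ℝ) : Prop where
  mem_I : ∀ i, i ∈ I ↔ ¬ ∃ c : ℝ, 0 < c ∧ StrongConvexOn Set.univ c (f i)
  mem_J : ∀ j, j ∈ J ↔ ¬ ∃ c : ℝ, 0 < c ∧ ExtStrongConvex c (g j)
  modulus_f : ∀ i, i ∉ I → 0 < mf ∧ StrongConvexOn Set.univ mf (f i)
  modulus_g : ∀ j, j ∉ J → 0 < mg ∧ ExtStrongConvex mg (g j)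

/-! ### Proximal augmented Lagrangian and primal-dual gradient flow dynamics -/

/-- The proximal augmented Lagrangian
`f(x) + M_{μg}(z + μ y) + (1/(2μ)) ‖E x + F z - q + μ λ‖² - (μ/2) ‖y‖² - (μ/2) ‖λ‖²`. -/
def proxAugLagrangian {k l p : ℕ} {m : Fin k → ℕ} {n : Fin l → ℕ}
    (E : BlockMatrix p m) (F : BlockMatrix p n) (q : EuclideanSpace ℝ (Fin p))
    (f : ∀ i, EuclideanSpace ℝ (Fin (m i)) → ℝ)
    (g : ∀ j, EuclideanSpace ℝ (Fin (n j)) → EReal) (μ : ℝ)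
    (x : BlockVec m) (z y : BlockVec n) (lam : EuclideanSpace ℝ (Fin p)) : ℝ :=
  smoothPart f x + moreau μ (nonsmoothPart g) (z + μ • y)
    + 1 / (2 * μ) * ‖residual E F q x z + μ • lam‖ ^ 2
    - μ / 2 * ‖y‖ ^ 2 - μ / 2 * ‖lam‖ ^ 2

/-- The proximal augmented Lagrangian is strongly convex with modulus `c` in the primal variables
`(x, z)`, for all values of the dual variables `(y, λ)`. -/
def PrimalStrongConvex {k l p : ℕ} {m : Fin k → ℕ} {n : Fin l → ℕ}
    (E : BlockMatrix p m) (F : BlockMatrix p n) (q : EuclideanSpace ℝ (Fin p))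
    (f : ∀ i, EuclideanSpace ℝ (Fin (m i)) → ℝ)
    (g : ∀ j, EuclideanSpace ℝ (Fin (n j)) → EReal) (μ c : ℝ) : Prop :=
  ∀ (y : BlockVec n) (lam : EuclideanSpace ℝ (Fin p)),
    StrongConvexOn Set.univ c
      (fun u : EuclideanSpace ℝ (BlockIndex m ⊕ BlockIndex n) =>
        proxAugLagrangian E F q f g μ (WithLp.toLp 2 (fun a => u (Sum.inl a)))
          (WithLp.toLp 2 (fun b => u (Sum.inr b))) y lam)

/-- The space of states `ψ = (x, z, y, λ)`, with the Euclidean norm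
`‖ψ‖² = ‖x‖² + ‖z‖² + ‖y‖² + ‖λ‖²`. -/
abbrev State {k l : ℕ} (m : Fin k → ℕ) (n : Fin l → ℕ) (p : ℕ) : Type :=
  EuclideanSpace ℝ ((BlockIndex m ⊕ BlockIndex n) ⊕ (BlockIndex n ⊕ Fin p))

namespace State

/-- The state `(x, z, y, λ)`. -/
def mk {k l p : ℕ} {m : Fin k → ℕ} {n : Fin l → ℕ}
    (x : BlockVec m) (z y : BlockVec n) (lam : EuclideanSpace ℝ (Fin p)) : State m n p :=
  WithLp.toLp 2 (Sum.elim (Sum.elim x z) (Sum.elim y lam))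

/-- The component `x` of a state. -/
def x {k l p : ℕ} {m : Fin k → ℕ} {n : Fin l → ℕ} (ψ : State m n p) : BlockVec m :=
  WithLp.toLp 2 (fun a => ψ (Sum.inl (Sum.inl a)))

/-- The component `z` of a state. -/
def z {k l p : ℕ} {m : Fin k → ℕ} {n : Fin l → ℕ} (ψ : State m n p) : BlockVec n :=
  WithLp.toLp 2 (fun b => ψ (Sum.inl (Sum.inr b)))

/-- The component `y` of a state. -/
def y {k l p : ℕ} {m : Fin k → ℕ} {n : Fin l → ℕ} (ψ : State m n p) : BlockVec n :=
  WithLp.toLp 2 (fun b => ψ (Sum.inr (Sum.inl b)))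

/-- The component `λ` of a state. -/
def lam {k l p : ℕ} {m : Fin k → ℕ} {n : Fin l → ℕ} (ψ : State m n p) :
    EuclideanSpace ℝ (Fin p) :=
  WithLp.toLp 2 (fun i => ψ (Sum.inr (Sum.inr i)))

end State

/-- The vector field `(-∇ₓ𝓛, -∇_z𝓛, α ∇_y𝓛, α ∇_λ𝓛)` of the primal-descent dual-ascent gradient
flow of the proximal augmented Lagrangian `𝓛`. -/
def flowField {k l p : ℕ} {m : Fin k → ℕ} {n : Fin l → ℕ}
    (E : BlockMatrix p m) (F : BlockMatrix p n) (q : EuclideanSpace ℝ (Fin p))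
    (f : ∀ i, EuclideanSpace ℝ (Fin (m i)) → ℝ)
    (g : ∀ j, EuclideanSpace ℝ (Fin (n j)) → EReal) (μ α : ℝ)
    (ψ : State m n p) : State m n p :=
  State.mk
    (-gradient (fun x => proxAugLagrangian E F q f g μ x ψ.z ψ.y ψ.lam) ψ.x)
    (-gradient (fun z => proxAugLagrangian E F q f g μ ψ.x z ψ.y ψ.lam) ψ.z)
    (α • gradient (fun y => proxAugLagrangian E F q f g μ ψ.x ψ.z y ψ.lam) ψ.y)
    (α • gradient (fun lam => proxAugLagrangian E F q f g μ ψ.x ψ.z ψ.y lam) ψ.lam)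

/-- `ψ` solves `dψ/dt = flowField ψ` on `[t₀, ∞)`. -/
def IsSolution {k l p : ℕ} {m : Fin k → ℕ} {n : Fin l → ℕ}
    (E : BlockMatrix p m) (F : BlockMatrix p n) (q : EuclideanSpace ℝ (Fin p))
    (f : ∀ i, EuclideanSpace ℝ (Fin (m i)) → ℝ)
    (g : ∀ j, EuclideanSpace ℝ (Fin (n j)) → EReal) (μ α t₀ : ℝ)
    (ψ : ℝ → State m n p) : Prop :=
  ∀ t, t₀ ≤ t → HasDerivWithinAt ψ (flowField E F q f g μ α (ψ t)) (Set.Ici t₀) t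

/-- The set of equilibrium points of the dynamics. -/
def equilibria {k l p : ℕ} {m : Fin k → ℕ} {n : Fin l → ℕ}
    (E : BlockMatrix p m) (F : BlockMatrix p n) (q : EuclideanSpace ℝ (Fin p))
    (f : ∀ i, EuclideanSpace ℝ (Fin (m i)) → ℝ)
    (g : ∀ j, EuclideanSpace ℝ (Fin (n j)) → EReal) (μ α : ℝ) : Set (State m n p) :=
  {ψ | flowField E F q f g μ α ψ = 0}

end

end PDFlow

/-!
# Exponential stability of the proximal primal-dual gradient flow

Write `G` for the gradient of the Moreau envelope of `g`, and let `x, z, y, λ` also denote the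
deviations of a trajectory from an equilibrium, `A` and `d` the deviations of `∇f` and `G`. Then
`x' = -A - Eᵀ((E x + F z)/μ + λ)`, `z' = -d - Fᵀ((E x + F z)/μ + λ)`, `y' = αμ (d - y)`,
`λ' = α (E x + F z)`. Along the flow the energy `½(‖x‖² + ‖z‖²) + (‖y‖² + ‖λ‖²)/(2α)` decreases at
the rate `⟨A, x⟩ + ‖E x + F z‖²/μ + ⟨d, z + μ(y - d)⟩ + μ‖d - y‖²` (`energy_deriv_eq`), where
`z + μ(y - d)` is the deviation of the proximal point. By strong convexity of the blocks outside
`I` and `J` and the full column rank of `[E_I F_J]`, this dissipation is at least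
`κ (‖x‖² + ‖z‖² + ‖d - y‖²)` (`exists_isDissipationBound`). It contains neither `λ` nor `y` itself;
adding small multiples of `⟨E x, λ⟩` and `⟨z, y⟩` to the energy makes these dissipate too, because
`Eᵀ` is bounded below on the range of `E`, to which `λ` belongs when the equilibrium is the one
nearest to the initial state. The result is a quadratic Lyapunov function with linear decay
(`exists_isExponentialBound`), whose constants depend on `f` only through the Lipschitz constant
of `∇f` and the strong convexity modulus, and on `g` only through its modulus.

Equilibria are the Karush-Kuhn-Tucker points (`mem_equilibria_iff`). They exist (`exists_isKKT`):
the objective is strongly convex on the feasible set, hence attains its minimum, and since the range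
of `F` lies in that of `E`, the multiplier that makes `f` stationary along the kernel of `E` serves
`g` as well. Vanishing of the dissipation between two equilibria shows that they differ only by an
element of `ker Eᵀ` in `λ` (`IsKKT.iff`); hence the set of equilibria is affine, and the component of
`λ` in `ker Eᵀ` is conserved by the flow, which identifies the limit as the orthogonal projection.

The strong convexity of the proximal augmented Lagrangian in `(x, z)`
(`exists_primalStrongConvex`) rests on the same coercivity, once strong convexity of blocks of `g` is
passed to the Moreau envelope (`ClosedStrongConvexAlong.moreau_combo_le`).
-/

namespace PDFlow

open scoped InnerProductSpace
open LinearMap (adjoint)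

/-! ### Extended-valued convex functions and the proximal operator -/

lemma coe_toReal_of_mem_effDom {V : Type} {g : V → EReal} (hbot : ∀ z, g z ≠ ⊥) {z : V}
    (hz : z ∈ effDom g) : (((g z).toReal : ℝ) : EReal) = g z :=
  EReal.coe_toReal (ne_of_lt hz) (hbot z)

lemma toReal_le_toReal_of_le {a b : EReal} (ha : a ≠ ⊥) (hb : b < ⊤) (h : a ≤ b) :
    a.toReal ≤ b.toReal :=
  EReal.toReal_le_toReal h ha hb.ne

/-- A closed strongly convex function attains its minimum over every closed set that meets its
domain. Comparing with the minimum over a unit ball around a point `z₀` shows that the sublevel set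
of `φ z₀` is bounded. -/
lemma exists_isMinOn_of_strongConvex {V : Type} [NormedAddCommGroup V] [NormedSpace ℝ V]
    [ProperSpace V] {φ : V → EReal} {c : ℝ} (hc : 0 < c) (hbot : ∀ z, φ z ≠ ⊥)
    (hlsc : LowerSemicontinuous φ)
    (hconv : ∀ u ∈ effDom φ, ∀ v ∈ effDom φ, ∀ a b : ℝ, 0 ≤ a → 0 ≤ b → a + b = 1 →
      φ (a • u + b • v) ≤
        ((a * (φ u).toReal + b * (φ v).toReal - c / 2 * (a * b) * ‖u - v‖ ^ 2 : ℝ) : EReal))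
    {C : Set V} (hC : IsClosed C) {z₀ : V} (hz₀ : z₀ ∈ C) (hdom : z₀ ∈ effDom φ) :
    ∃ w ∈ C, IsMinOn φ C w := by
  obtain ⟨w₁, hw₁, hmin₁⟩ := LowerSemicontinuousOn.exists_isMinOn (f := φ)
    (s := Metric.closedBall z₀ 1) ⟨z₀, by simp⟩ (isCompact_closedBall _ _)
    (hlsc.lowerSemicontinuousOn _)
  have hw₁z₀ : φ w₁ ≤ φ z₀ := hmin₁ (by simp)
  have hw₁dom : w₁ ∈ effDom φ := lt_of_le_of_lt hw₁z₀ hdom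
  set c₀ := (φ w₁).toReal
  set s := (φ z₀).toReal
  have hcs : c₀ ≤ s := toReal_le_toReal_of_le (hbot _) hdom hw₁z₀
  set R : ℝ := 1 + 2 * (s - c₀) / c
  have hR1 : 1 ≤ R := by
    have : 0 ≤ 2 * (s - c₀) / c := div_nonneg (by linarith) hc.le
    simp only [R]; linarith
  have hout : ∀ u, R < ‖u - z₀‖ → φ z₀ < φ u := by
    intro u hu
    by_contra! hle
    have hudom : u ∈ effDom φ := lt_of_le_of_lt hle hdom
    have hus : (φ u).toReal ≤ s := toReal_le_toReal_of_le (hbot _) hdom hle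
    set r := ‖u - z₀‖
    have hr : 1 < r := lt_of_le_of_lt hR1 hu
    have hr0 : 0 < r := by linarith
    have h1r : 0 ≤ 1 - 1 / r := by
      rw [sub_nonneg, div_le_one hr0]; exact hr.le
    have hw := hconv u hudom z₀ hdom (1 / r) (1 - 1 / r) (by positivity) h1r (by ring)
    have hmem : (1 / r) • u + (1 - 1 / r) • z₀ ∈ Metric.closedBall z₀ 1 := by
      rw [mem_closedBall_iff_norm]
      have : (1 / r) • u + (1 - 1 / r) • z₀ - z₀ = (1 / r) • (u - z₀) := by
        rw [smul_sub, sub_smul, one_smul]; abel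
      rw [this, norm_smul, Real.norm_of_nonneg (by positivity)]
      exact (one_div_mul_cancel hr0.ne').le
    have hle' : ((c₀ : ℝ) : EReal) ≤ _ :=
      le_trans (le_of_eq (coe_toReal_of_mem_effDom hbot hw₁dom)) ((hmin₁ hmem).trans hw)
    rw [EReal.coe_le_coe_iff] at hle'
    have e : c / 2 * (1 / r * (1 - 1 / r)) * r ^ 2 = c / 2 * (r - 1) := by
      field_simp
    change c₀ ≤ 1 / r * (φ u).toReal + (1 - 1 / r) * s
      - c / 2 * (1 / r * (1 - 1 / r)) * r ^ 2 at hle'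
    rw [e] at hle'
    have h3 : 1 / r * (φ u).toReal ≤ 1 / r * s :=
      mul_le_mul_of_nonneg_left hus (by positivity)
    have h4 : c / 2 * (r - 1) ≤ s - c₀ := by linarith
    have h5 : 2 * (s - c₀) / c < r - 1 := by
      simp only [R] at hu; linarith
    rw [div_lt_iff₀ hc] at h5
    linarith
  obtain ⟨w, hw, hmin⟩ := LowerSemicontinuousOn.exists_isMinOn (f := φ)
    (s := Metric.closedBall z₀ R ∩ C) ⟨z₀, by simp; linarith, hz₀⟩
    ((isCompact_closedBall _ _).inter_right hC) (hlsc.lowerSemicontinuousOn _)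
  refine ⟨w, hw.2, fun u hu => ?_⟩
  by_cases h : ‖u - z₀‖ ≤ R
  · exact hmin ⟨by simpa [dist_eq_norm] using h, hu⟩
  · exact le_trans (hmin ⟨by simp; linarith, hz₀⟩) (hout u (not_le.mp h)).le

lemma norm_combo_sq {V : Type} [NormedAddCommGroup V] [InnerProductSpace ℝ V]
    {a b : ℝ} (hab : a + b = 1) (x y : V) :
    ‖a • x + b • y‖ ^ 2 = a * ‖x‖ ^ 2 + b * ‖y‖ ^ 2 - a * b * ‖x - y‖ ^ 2 := by
  rw [norm_add_sq_real, norm_sub_sq_real, norm_smul, norm_smul, real_inner_smul_left,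
    real_inner_smul_right, mul_pow, mul_pow, Real.norm_eq_abs, Real.norm_eq_abs, sq_abs, sq_abs]
  obtain rfl : b = 1 - a := by linarith
  ring

variable {V W : Type} [NormedAddCommGroup V] [InnerProductSpace ℝ V] [NormedAddCommGroup W]
  [InnerProductSpace ℝ W]

/-- A proper closed convex function whose convexity inequality holds with the additional term
`-(c/2) a b ‖T (u - v)‖²`. With `T` the projection onto some of the coordinates this expresses
strong convexity in these coordinates only; `c = 0` is plain convexity. -/
structure ClosedStrongConvexAlong (c : ℝ) (T : V →ₗ[ℝ] W) (g : V → EReal) : Prop where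
  ne_bot : ∀ z, g z ≠ ⊥
  nonempty_effDom : (effDom g).Nonempty
  lowerSemicontinuous : LowerSemicontinuous g
  le : ∀ u ∈ effDom g, ∀ v ∈ effDom g, ∀ a b : ℝ, 0 ≤ a → 0 ≤ b → a + b = 1 →
    g (a • u + b • v) ≤
      ((a * (g u).toReal + b * (g v).toReal - c / 2 * (a * b) * ‖T (u - v)‖ ^ 2 : ℝ) : EReal)

namespace ClosedStrongConvexAlong

variable {c μ : ℝ} {T : V →ₗ[ℝ] W} {g : V → EReal}

lemma mem_effDom (h : ClosedStrongConvexAlong c T g) {u v : V} (hu : u ∈ effDom g)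
    (hv : v ∈ effDom g) {a b : ℝ} (ha : 0 ≤ a) (hb : 0 ≤ b) (hab : a + b = 1) :
    a • u + b • v ∈ effDom g :=
  lt_of_le_of_lt (h.le u hu v hv a b ha hb hab) (EReal.coe_lt_top _)

lemma toReal_le (h : ClosedStrongConvexAlong c T g) {u v : V} (hu : u ∈ effDom g)
    (hv : v ∈ effDom g) {a b : ℝ} (ha : 0 ≤ a) (hb : 0 ≤ b) (hab : a + b = 1) :
    (g (a • u + b • v)).toReal ≤
      a * (g u).toReal + b * (g v).toReal - c / 2 * (a * b) * ‖T (u - v)‖ ^ 2 := by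
  have := h.le u hu v hv a b ha hb hab
  rw [← coe_toReal_of_mem_effDom h.ne_bot (h.mem_effDom hu hv ha hb hab)] at this
  exact EReal.coe_le_coe_iff.mp this

lemma isProx_iff (h : ClosedStrongConvexAlong c T g) {v w : V} :
    IsProx μ g v w ↔ w ∈ effDom g ∧ ∀ u ∈ effDom g,
      (g w).toReal + 1 / (2 * μ) * ‖w - v‖ ^ 2 ≤ (g u).toReal + 1 / (2 * μ) * ‖u - v‖ ^ 2 := by
  have key : ∀ w ∈ effDom g, g w + ((1 / (2 * μ) * ‖w - v‖ ^ 2 : ℝ) : EReal) =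
      (((g w).toReal + 1 / (2 * μ) * ‖w - v‖ ^ 2 : ℝ) : EReal) := by
    intro w hw
    rw [EReal.coe_add, coe_toReal_of_mem_effDom h.ne_bot hw]
  constructor
  · intro hp
    obtain ⟨u₀, hu₀⟩ := h.nonempty_effDom
    have hw : w ∈ effDom g := by
      have h1 := hp u₀
      rw [key u₀ hu₀] at h1
      by_contra hw
      have hw' : g w = ⊤ := not_lt_top_iff.mp hw
      rw [hw', EReal.top_add_coe] at h1
      exact absurd h1 (not_le.mpr (EReal.coe_lt_top _))
    refine ⟨hw, fun u hu => ?_⟩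
    have h1 := hp u
    rw [key u hu, key w hw] at h1
    exact EReal.coe_le_coe_iff.mp h1
  · rintro ⟨hw, hmin⟩ u
    by_cases hu : u ∈ effDom g
    · rw [key u hu, key w hw]
      exact EReal.coe_le_coe_iff.mpr (hmin u hu)
    · have hu' : g u = ⊤ := not_lt_top_iff.mp hu
      rw [hu', EReal.top_add_coe]
      exact le_top

end ClosedStrongConvexAlong

/-! ### The proximal operator and the Moreau envelope -/

/-- A real number that is at most every small positive multiple of `K` is nonpositive. -/
lemma nonpos_of_forall_le_mul {X K : ℝ} (h : ∀ t : ℝ, 0 < t → t < 1 → X ≤ t * K) : X ≤ 0 := by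
  by_contra! hX
  have hK : 0 < K := by
    have := h (1 / 2) (by norm_num) (by norm_num)
    linarith
  have h1 := h (X / (2 * K + X)) (by positivity) (by rw [div_lt_one (by positivity)]; linarith)
  rw [div_mul_eq_mul_div, le_div_iff₀ (by positivity)] at h1
  nlinarith

/-- The gradient `(v - prox_{μg}(v)) / μ` of the Moreau envelope. -/
noncomputable def moreauGrad {V : Type} [NormedAddCommGroup V] [InnerProductSpace ℝ V] (μ : ℝ)
    (g : V → EReal) (v : V) : V :=
  (1 / μ) • (v - prox μ g v)

namespace ClosedStrongConvexAlong

variable {V W : Type} [NormedAddCommGroup V] [InnerProductSpace ℝ V] [NormedAddCommGroup W]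
  [InnerProductSpace ℝ W] {c μ : ℝ} {T : V →ₗ[ℝ] W} {g : V → EReal}

lemma exists_isProx [FiniteDimensional ℝ V] (h : ClosedStrongConvexAlong c T g) (hc : 0 ≤ c)
    (hμ : 0 < μ) (v : V) : ∃ w, IsProx μ g v w := by
  have : ProperSpace V := FiniteDimensional.proper ℝ V
  obtain ⟨z₀, hz₀⟩ := h.nonempty_effDom
  set φ : V → EReal := fun u => g u + ((1 / (2 * μ) * ‖u - v‖ ^ 2 : ℝ) : EReal)
  have hdom : ∀ u, u ∈ effDom φ → u ∈ effDom g := by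
    intro u hu
    by_contra hu'
    have : g u = ⊤ := not_lt_top_iff.mp hu'
    have hφ : φ u = ⊤ := by simp only [φ, this, EReal.top_add_coe]
    exact absurd hu (by simp [effDom, hφ])
  have hφ : ∀ u ∈ effDom g,
      φ u = (((g u).toReal + 1 / (2 * μ) * ‖u - v‖ ^ 2 : ℝ) : EReal) := by
    intro u hu
    rw [EReal.coe_add, coe_toReal_of_mem_effDom h.ne_bot hu]
  have hlsc : LowerSemicontinuous φ := by
    refine h.lowerSemicontinuous.add' ?_ fun u => EReal.continuousAt_add ?_ ?_
    · exact (continuous_coe_real_ereal.comp (by fun_prop)).lowerSemicontinuous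
    · right; exact EReal.coe_ne_bot _
    · left; exact h.ne_bot u
  have hconv : ∀ u ∈ effDom φ, ∀ v ∈ effDom φ, ∀ a b : ℝ, 0 ≤ a → 0 ≤ b → a + b = 1 →
      φ (a • u + b • v) ≤ ((a * (φ u).toReal + b * (φ v).toReal
        - 1 / μ / 2 * (a * b) * ‖u - v‖ ^ 2 : ℝ) : EReal) := by
    intro u hu w hw a b ha hb hab
    have hu' := hdom u hu
    have hw' := hdom w hw
    rw [hφ u hu', hφ w hw', hφ _ (h.mem_effDom hu' hw' ha hb hab), EReal.toReal_coe,
      EReal.toReal_coe, EReal.coe_le_coe_iff]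
    have h1 := h.toReal_le hu' hw' ha hb hab
    have h2 : a • u + b • w - v = a • (u - v) + b • (w - v) := by
      rw [smul_sub, smul_sub]
      nth_rewrite 1 [← one_smul ℝ v]
      rw [← hab, add_smul]; abel
    rw [h2, norm_combo_sq hab, sub_sub_sub_cancel_right]
    have h3 : 0 ≤ c / 2 * (a * b) * ‖T (u - w)‖ ^ 2 := by positivity
    have h4 : 1 / (2 * μ) = 1 / μ / 2 := by field_simp
    rw [h4]
    linarith
  obtain ⟨w, -, hw⟩ := exists_isMinOn_of_strongConvex (φ := φ) (c := 1 / μ) (by positivity)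
    (fun u => by
      simp only [φ, ne_eq, EReal.add_eq_bot_iff, h.ne_bot u, EReal.coe_ne_bot, or_self,
        not_false_eq_true]) hlsc
    hconv isClosed_univ
    (Set.mem_univ z₀) (by
      change φ z₀ < ⊤
      rw [hφ z₀ hz₀]
      exact EReal.coe_lt_top _)
  exact ⟨w, fun u => hw (Set.mem_univ u)⟩

lemma isProx_prox [FiniteDimensional ℝ V] (h : ClosedStrongConvexAlong c T g) (hc : 0 ≤ c)
    (hμ : 0 < μ) (v : V) : IsProx μ g v (prox μ g v) :=
  Classical.epsilon_spec (h.exists_isProx hc hμ v)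

lemma prox_mem_effDom [FiniteDimensional ℝ V] (h : ClosedStrongConvexAlong c T g) (hc : 0 ≤ c)
    (hμ : 0 < μ) (v : V) : prox μ g v ∈ effDom g :=
  (h.isProx_iff.mp (h.isProx_prox hc hμ v)).1

/-- A proximal point `w` of `v` satisfies the optimality condition `(v - w)/μ ∈ ∂g(w)`, with the
quadratic term that strong convexity adds to the subgradient inequality. -/
lemma subgradient_of_isProx (h : ClosedStrongConvexAlong c T g) (hμ : 0 < μ) {v w : V}
    (hw : IsProx μ g v w) {u : V} (hu : u ∈ effDom g) :
    (g w).toReal + ⟪(1 / μ) • (v - w), u - w⟫_ℝ + c / 2 * ‖T (u - w)‖ ^ 2 ≤ (g u).toReal := by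
  obtain ⟨hwd, hmin⟩ := h.isProx_iff.mp hw
  have key := nonpos_of_forall_le_mul
    (X := (g w).toReal + ⟪(1 / μ) • (v - w), u - w⟫_ℝ + c / 2 * ‖T (u - w)‖ ^ 2 - (g u).toReal)
    (K := c / 2 * ‖T (u - w)‖ ^ 2 + 1 / (2 * μ) * ‖u - w‖ ^ 2) ?_
  · linarith
  intro t ht0 ht1
  have h1 := h.toReal_le hu hwd ht0.le (by linarith : 0 ≤ 1 - t) (by ring)
  have h2 := hmin _ (h.mem_effDom hu hwd ht0.le (by linarith : 0 ≤ 1 - t) (by ring))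
  have e1 : t • u + (1 - t) • w - v = t • (u - w) - (v - w) := by
    rw [smul_sub, sub_smul, one_smul]; abel
  rw [e1, norm_sub_sq_real (t • (u - w)), norm_smul, real_inner_smul_left, norm_sub_rev w v,
    Real.norm_of_nonneg ht0.le, mul_pow] at h2
  rw [real_inner_smul_left, real_inner_comm]
  have h3 : t * ((g w).toReal + 1 / μ * ⟪u - w, v - w⟫_ℝ + c / 2 * ‖T (u - w)‖ ^ 2
      - (g u).toReal) ≤
      t * (t * (c / 2 * ‖T (u - w)‖ ^ 2 + 1 / (2 * μ) * ‖u - w‖ ^ 2)) := by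
    have e2 : 1 / μ = 2 * (1 / (2 * μ)) := by field_simp
    rw [e2]
    nlinarith
  exact le_of_mul_le_mul_left h3 ht0

lemma isProx_of_subgradient (h : ClosedStrongConvexAlong c T g) (hμ : 0 < μ) {w s : V}
    (hw : w ∈ effDom g) (hs : ∀ u ∈ effDom g, (g w).toReal + ⟪s, u - w⟫_ℝ ≤ (g u).toReal) :
    IsProx μ g (w + μ • s) w := by
  refine h.isProx_iff.mpr ⟨hw, fun u hu => ?_⟩
  have h1 := hs u hu
  have e1 : u - (w + μ • s) = (u - w) - μ • s := by abel
  have e2 : w - (w + μ • s) = -(μ • s) := by abel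
  rw [e1, e2, norm_sub_sq_real, norm_neg, real_inner_smul_right, real_inner_comm]
  have e3 : 1 / (2 * μ) * (‖u - w‖ ^ 2 - 2 * (μ * ⟪s, u - w⟫_ℝ) + ‖μ • s‖ ^ 2) =
      1 / (2 * μ) * ‖u - w‖ ^ 2 - ⟪s, u - w⟫_ℝ + 1 / (2 * μ) * ‖μ • s‖ ^ 2 := by
    field_simp
  rw [e3]
  have h2 : 0 ≤ 1 / (2 * μ) * ‖u - w‖ ^ 2 := by positivity
  linarith

/-- Strong monotonicity of the subdifferential, at two proximal points. -/
lemma le_inner_of_isProx (h : ClosedStrongConvexAlong c T g) (hμ : 0 < μ) {v v' w w' : V}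
    (hw : IsProx μ g v w) (hw' : IsProx μ g v' w') :
    c * ‖T (w - w')‖ ^ 2 ≤ ⟪(1 / μ) • (v - w) - (1 / μ) • (v' - w'), w - w'⟫_ℝ := by
  have h1 := h.subgradient_of_isProx hμ hw (h.isProx_iff.mp hw').1
  have h2 := h.subgradient_of_isProx hμ hw' (h.isProx_iff.mp hw).1
  rw [← neg_sub w w', map_neg, norm_neg, inner_neg_right] at h1
  rw [inner_sub_left]
  linarith

lemma prox_eq_of_isProx [FiniteDimensional ℝ V] (h : ClosedStrongConvexAlong c T g) (hc : 0 ≤ c)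
    (hμ : 0 < μ) {v w : V} (hw : IsProx μ g v w) : prox μ g v = w := by
  have h1 := h.le_inner_of_isProx hμ (h.isProx_prox hc hμ v) hw
  rw [← smul_sub, sub_sub_sub_cancel_left, ← neg_sub (prox μ g v) w, smul_neg, inner_neg_left,
    real_inner_smul_left, real_inner_self_eq_norm_sq] at h1
  have h2 : 0 ≤ c * ‖T (prox μ g v - w)‖ ^ 2 := by positivity
  have h3 : 1 / μ * ‖prox μ g v - w‖ ^ 2 ≤ 0 := by linarith
  have h4 : ‖prox μ g v - w‖ ^ 2 ≤ 0 :=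
    nonpos_of_mul_nonpos_right h3 (by positivity)
  have h5 : ‖prox μ g v - w‖ = 0 := by
    have := sq_nonneg ‖prox μ g v - w‖
    exact pow_eq_zero_iff (two_ne_zero) |>.mp (le_antisymm h4 this)
  exact sub_eq_zero.mp (norm_eq_zero.mp h5)

lemma prox_eq_sub (hμ : 0 < μ) (v : V) : prox μ g v = v - μ • moreauGrad μ g v := by
  rw [moreauGrad, smul_smul, mul_one_div_cancel hμ.ne', one_smul, sub_sub_cancel]

lemma le_inner_moreauGrad [FiniteDimensional ℝ V] (h : ClosedStrongConvexAlong c T g)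
    (hc : 0 ≤ c) (hμ : 0 < μ) (v v' : V) :
    c * ‖T (v - v' - μ • (moreauGrad μ g v - moreauGrad μ g v'))‖ ^ 2 ≤
      ⟪moreauGrad μ g v - moreauGrad μ g v',
        v - v' - μ • (moreauGrad μ g v - moreauGrad μ g v')⟫_ℝ := by
  have h1 := h.le_inner_of_isProx hμ (h.isProx_prox hc hμ v) (h.isProx_prox hc hμ v')
  have e : v - v' - μ • (moreauGrad μ g v - moreauGrad μ g v') = prox μ g v - prox μ g v' := by
    rw [prox_eq_sub hμ, prox_eq_sub hμ, smul_sub]; abel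
  rw [e]
  exact h1

lemma norm_moreauGrad_sub_le [FiniteDimensional ℝ V] (h : ClosedStrongConvexAlong c T g)
    (hc : 0 ≤ c) (hμ : 0 < μ) (v v' : V) :
    ‖moreauGrad μ g v - moreauGrad μ g v'‖ ≤ 1 / μ * ‖v - v'‖ := by
  have h1 := h.le_inner_moreauGrad hc hμ v v'
  set d := moreauGrad μ g v - moreauGrad μ g v'
  rw [inner_sub_right, real_inner_smul_right, real_inner_self_eq_norm_sq] at h1
  have h2 : 0 ≤ c * ‖T (v - v' - μ • d)‖ ^ 2 := by positivity
  have h3 := real_inner_le_norm d (v - v')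
  rcases eq_or_lt_of_le (norm_nonneg d) with h0 | h0
  · rw [← h0]; positivity
  · rw [div_mul_eq_mul_div, one_mul, le_div_iff₀ hμ]
    have : ‖d‖ * (‖d‖ * μ) ≤ ‖d‖ * ‖v - v'‖ := by nlinarith
    exact le_of_mul_le_mul_left this h0

lemma moreau_le [FiniteDimensional ℝ V] (h : ClosedStrongConvexAlong c T g) (hc : 0 ≤ c)
    (hμ : 0 < μ) (v : V) {u : V} (hu : u ∈ effDom g) :
    moreau μ g v ≤ (g u).toReal + 1 / (2 * μ) * ‖u - v‖ ^ 2 :=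
  (h.isProx_iff.mp (h.isProx_prox hc hμ v)).2 u hu

/-- Quadratic upper bound for the Moreau envelope, from using `prox_{μg}(v)` as a competitor in
the minimization that defines the envelope at `v'`. -/
lemma moreau_le_add [FiniteDimensional ℝ V] (h : ClosedStrongConvexAlong c T g) (hc : 0 ≤ c)
    (hμ : 0 < μ) (v v' : V) :
    moreau μ g v' ≤ moreau μ g v + ⟪moreauGrad μ g v, v' - v⟫_ℝ
      + 1 / (2 * μ) * ‖v' - v‖ ^ 2 := by
  have h1 := h.moreau_le hc hμ v' (h.prox_mem_effDom hc hμ v)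
  have e : prox μ g v - v' = (prox μ g v - v) - (v' - v) := by abel
  rw [e, norm_sub_sq_real] at h1
  have e2 : ⟪moreauGrad μ g v, v' - v⟫_ℝ = - (1 / μ * ⟪prox μ g v - v, v' - v⟫_ℝ) := by
    rw [moreauGrad, ← neg_sub (prox μ g v) v, smul_neg, inner_neg_left, real_inner_smul_left]
  rw [e2]
  have e3 : 1 / μ = 2 * (1 / (2 * μ)) := by field_simp
  rw [e3]
  have : moreau μ g v = (g (prox μ g v)).toReal + 1 / (2 * μ) * ‖prox μ g v - v‖ ^ 2 := rfl
  linarith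

lemma hasGradientAt_moreau [FiniteDimensional ℝ V] [CompleteSpace V]
    (h : ClosedStrongConvexAlong c T g) (hc : 0 ≤ c) (hμ : 0 < μ) (v : V) :
    HasGradientAt (moreau μ g) (moreauGrad μ g v) v := by
  rw [hasGradientAt_iff_isLittleO]
  refine Asymptotics.IsBigO.trans_isLittleO (g := fun v' => ‖v' - v‖ ^ 2) ?_ ?_
  · refine Asymptotics.IsBigO.of_bound (2 / μ) (Filter.Eventually.of_forall fun v' => ?_)
    have h1 := h.moreau_le_add hc hμ v v'
    have h2 := h.moreau_le_add hc hμ v' v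
    have h3 : ⟪moreauGrad μ g v', v - v'⟫_ℝ = - ⟪moreauGrad μ g v, v' - v⟫_ℝ
        - ⟪moreauGrad μ g v' - moreauGrad μ g v, v' - v⟫_ℝ := by
      rw [← neg_sub v' v, inner_neg_right, inner_sub_left]; ring
    have h4 := abs_real_inner_le_norm (moreauGrad μ g v' - moreauGrad μ g v) (v' - v)
    have h5 := mul_le_mul_of_nonneg_right (h.norm_moreauGrad_sub_le hc hμ v' v)
      (norm_nonneg (v' - v))
    have h6 := abs_le.mp (h4.trans h5)
    rw [norm_sub_rev v v'] at h2
    have e : 1 / (2 * μ) * ‖v' - v‖ ^ 2 = 1 / 2 * (1 / μ * ‖v' - v‖ ^ 2) := by field_simp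
    have e' : 2 / μ * ‖v' - v‖ ^ 2 = 2 * (1 / μ * ‖v' - v‖ ^ 2) := by field_simp
    have e'' : 1 / μ * ‖v' - v‖ * ‖v' - v‖ = 1 / μ * ‖v' - v‖ ^ 2 := by ring
    rw [e''] at h6
    have h7 : 0 ≤ 1 / μ * ‖v' - v‖ ^ 2 := by positivity
    rw [Real.norm_of_nonneg (sq_nonneg ‖v' - v‖), e', Real.norm_eq_abs, abs_le]
    constructor <;> linarith [h6.1, h6.2]
  · exact Asymptotics.IsLittleO.congr' (Asymptotics.isLittleO_norm_pow_id one_lt_two |>.comp_tendsto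
      (k := fun v' => v' - v) (l' := nhds v) (by
        exact tendsto_sub_nhds_zero_iff.mpr Filter.tendsto_id))
      (Filter.EventuallyEq.rfl) Filter.EventuallyEq.rfl

/-- Strong convexity of `g` with modulus `c` passes to the Moreau envelope with modulus
`c / (1 + μ c)`. The two quadratic terms that appear, in the differences of the proximal points and
of the proximal residuals, are minimized jointly for a fixed difference of the arguments. -/
lemma moreau_combo_le [FiniteDimensional ℝ V] (h : ClosedStrongConvexAlong c T g) (hc : 0 ≤ c)
    (hμ : 0 < μ) (hT : ∀ d, ‖T d‖ ≤ ‖d‖) (v v' : V) {a b : ℝ} (ha : 0 ≤ a) (hb : 0 ≤ b)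
    (hab : a + b = 1) :
    moreau μ g (a • v + b • v') ≤ a * moreau μ g v + b * moreau μ g v'
      - a * b * (c / (1 + μ * c) / 2 * ‖T (v - v')‖ ^ 2) := by
  set w := prox μ g v
  set w' := prox μ g v'
  have hw := h.prox_mem_effDom hc hμ v
  have hw' := h.prox_mem_effDom hc hμ v'
  have h1 := h.moreau_le hc hμ (a • v + b • v') (h.mem_effDom hw hw' ha hb hab)
  have h2 := h.toReal_le hw hw' ha hb hab
  have e : a • w + b • w' - (a • v + b • v') = a • (w - v) + b • (w' - v') := by
    simp only [smul_sub]; abel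
  rw [e, norm_combo_sq hab] at h1
  have e2 : T (v - v') = T (w - w') - T ((w - v) - (w' - v')) := by
    rw [← map_sub]; congr 1; abel
  have h3 := hT ((w - v) - (w' - v'))
  have h4 : ‖T (v - v')‖ ≤ ‖T (w - w')‖ + ‖(w - v) - (w' - v')‖ := by
    rw [e2]; exact (norm_sub_le _ _).trans (by linarith)
  set s := ‖T (w - w')‖
  set r := ‖(w - v) - (w' - v')‖
  have hs : 0 ≤ s := norm_nonneg _
  have hr : 0 ≤ r := norm_nonneg _
  have h5 : c / (1 + μ * c) * ‖T (v - v')‖ ^ 2 ≤ c * s ^ 2 + 1 / μ * r ^ 2 := by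
    have h6 : ‖T (v - v')‖ ^ 2 ≤ (s + r) ^ 2 := pow_le_pow_left₀ (norm_nonneg _) h4 2
    have h7 : c / (1 + μ * c) * ‖T (v - v')‖ ^ 2 ≤ c / (1 + μ * c) * (s + r) ^ 2 :=
      mul_le_mul_of_nonneg_left h6 (by positivity)
    refine h7.trans ?_
    rw [div_mul_eq_mul_div, div_le_iff₀ (by positivity)]
    have : (c * s ^ 2 + 1 / μ * r ^ 2) * (1 + μ * c) - c * (s + r) ^ 2 =
        1 / μ * (μ * c * s - r) ^ 2 := by
      field_simp; ring
    have h8 : 0 ≤ 1 / μ * (μ * c * s - r) ^ 2 := by positivity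
    linarith
  have h9 : moreau μ g v = (g w).toReal + 1 / (2 * μ) * ‖w - v‖ ^ 2 := rfl
  have h10 : moreau μ g v' = (g w').toReal + 1 / (2 * μ) * ‖w' - v'‖ ^ 2 := rfl
  have h11 := mul_le_mul_of_nonneg_left h5 (mul_nonneg ha hb)
  rw [h9, h10]
  have e5 : 1 / μ = 2 * (1 / (2 * μ)) := by field_simp
  rw [e5] at h11
  calc _ ≤ _ := h1
    _ ≤ _ := by linarith

end ClosedStrongConvexAlong

/-! ### Coercivity of linear maps in finite dimension -/

section Coercivity

lemma exists_mul_sq_norm_le {V W : Type} [NormedAddCommGroup V] [NormedSpace ℝ V]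
    [FiniteDimensional ℝ V] [NormedAddCommGroup W] [NormedSpace ℝ W] (A : V →ₗ[ℝ] W)
    (hA : A.ker = ⊥) : ∃ κ : ℝ, 0 < κ ∧ ∀ v, κ * ‖v‖ ^ 2 ≤ ‖A v‖ ^ 2 := by
  obtain ⟨K, hK, hanti⟩ := A.exists_antilipschitzWith hA
  have hK' : (0 : ℝ) < K := hK
  refine ⟨1 / (K : ℝ) ^ 2, by positivity, fun v => ?_⟩
  have h1 : ‖v‖ ≤ K * ‖A v‖ := by
    have := hanti.le_mul_dist v 0
    simpa [dist_eq_norm] using this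
  rw [div_mul_eq_mul_div, one_mul, div_le_iff₀ (by positivity)]
  calc ‖v‖ ^ 2 ≤ (K * ‖A v‖) ^ 2 := pow_le_pow_left₀ (norm_nonneg _) h1 2
    _ = ‖A v‖ ^ 2 * (K : ℝ) ^ 2 := by ring

/-- A linear map is bounded below on the orthogonal complement of its kernel. -/
lemma exists_mul_sq_norm_le_of_orthogonal_ker {V W : Type} [NormedAddCommGroup V]
    [InnerProductSpace ℝ V] [FiniteDimensional ℝ V] [NormedAddCommGroup W] [NormedSpace ℝ W]
    (A : V →ₗ[ℝ] W) :
    ∃ σ : ℝ, 0 < σ ∧ ∀ v, (∀ w, A w = 0 → ⟪w, v⟫_ℝ = 0) → σ * ‖v‖ ^ 2 ≤ ‖A v‖ ^ 2 := by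
  obtain ⟨σ, hσ, h⟩ := exists_mul_sq_norm_le (A.domRestrict A.kerᗮ) (by
    rw [LinearMap.ker_eq_bot']
    rintro ⟨v, hv⟩ h
    have h1 : v ∈ A.ker := h
    exact Subtype.ext (inner_self_eq_zero.mp (hv v h1)))
  exact ⟨σ, hσ, fun v hv => h ⟨v, fun w hw => hv w hw⟩⟩

variable {X Z X' Z' P : Type} [NormedAddCommGroup X] [InnerProductSpace ℝ X]
  [NormedAddCommGroup Z] [InnerProductSpace ℝ Z] [NormedAddCommGroup X'] [InnerProductSpace ℝ X']
  [NormedAddCommGroup Z'] [InnerProductSpace ℝ Z'] [NormedAddCommGroup P] [InnerProductSpace ℝ P]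

lemma exists_mul_add_sq_norm_le [FiniteDimensional ℝ X] [FiniteDimensional ℝ Z]
    (S : X →ₗ[ℝ] X') (T : Z →ₗ[ℝ] Z')
    (E : X →ₗ[ℝ] P) (F : Z →ₗ[ℝ] P)
    (hinj : ∀ x z, S x = 0 → T z = 0 → E x + F z = 0 → x = 0 ∧ z = 0) :
    ∃ κ : ℝ, 0 < κ ∧ ∀ x z,
      κ * (‖x‖ ^ 2 + ‖z‖ ^ 2) ≤ ‖S x‖ ^ 2 + ‖T z‖ ^ 2 + ‖E x + F z‖ ^ 2 := by
  obtain ⟨κ, hκ, h⟩ := exists_mul_sq_norm_le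
    (LinearMap.prod (LinearMap.prodMap S T) (LinearMap.coprod E F)) (by
      rw [LinearMap.ker_eq_bot']
      rintro ⟨x, z⟩ h
      have h' : ((S x, T z), E x + F z) = 0 := h
      simp only [Prod.mk_eq_zero] at h'
      obtain ⟨h1, h2⟩ := hinj x z h'.1.1 h'.1.2 h'.2
      rw [h1, h2]; rfl)
  refine ⟨κ / 2, by positivity, fun x z => ?_⟩
  have h1 : κ * ‖(x, z)‖ ^ 2 ≤ ‖((S x, T z), E x + F z)‖ ^ 2 := h (x, z)
  have h2 : ‖x‖ ^ 2 + ‖z‖ ^ 2 ≤ 2 * ‖(x, z)‖ ^ 2 := by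
    have hx := pow_le_pow_left₀ (norm_nonneg _) (norm_fst_le (x, z)) 2
    have hz := pow_le_pow_left₀ (norm_nonneg _) (norm_snd_le (x, z)) 2
    simp only at hx hz
    linarith
  have h3 : ‖((S x, T z), E x + F z)‖ ^ 2 ≤ ‖S x‖ ^ 2 + ‖T z‖ ^ 2 + ‖E x + F z‖ ^ 2 := by
    have hs := sq_nonneg ‖S x‖
    have ht := sq_nonneg ‖T z‖
    have hr := sq_nonneg ‖E x + F z‖
    rw [Prod.norm_mk, Prod.norm_mk]
    rcases max_choice (max ‖S x‖ ‖T z‖) ‖E x + F z‖ with h | h <;> rw [h]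
    · rcases max_choice ‖S x‖ ‖T z‖ with h | h <;> rw [h] <;> linarith
    · linarith
  nlinarith

/-- `κ` is a constant with which the dissipation of the quadratic energy controls the primal
errors `x`, `z` and the mismatch `d - y`. Here `A` and `d` stand for the increments of the gradient
of the smooth part and of the gradient of the Moreau envelope, so that `z + μ (y - d)` is the
increment of the proximal point; the two hypotheses are strong monotonicity along `S` and `T`. -/
def IsDissipationBound (S : X →ₗ[ℝ] X') (T : Z →ₗ[ℝ] Z') (E : X →ₗ[ℝ] P) (F : Z →ₗ[ℝ] P)
    (μ cf cg κ : ℝ) : Prop :=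
  ∀ (x A : X) (z y d : Z), cf * ‖S x‖ ^ 2 ≤ ⟪A, x⟫_ℝ →
    cg * ‖T (z + μ • (y - d))‖ ^ 2 ≤ ⟪d, z + μ • (y - d)⟫_ℝ →
    κ * (‖x‖ ^ 2 + ‖z‖ ^ 2 + ‖d - y‖ ^ 2) ≤ ⟪A, x⟫_ℝ + 1 / μ * ‖E x + F z‖ ^ 2
      + ⟪d, z + μ • (y - d)⟫_ℝ + μ * ‖d - y‖ ^ 2

/-- The dissipation controls the strongly convex coordinates of `x` and of the proximal point, and
`E x + F z`. Those of `z` differ from those of the proximal point by at most the mismatch. -/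
lemma exists_isDissipationBound [FiniteDimensional ℝ X] [FiniteDimensional ℝ Z]
    (S : X →ₗ[ℝ] X') (T : Z →ₗ[ℝ] Z') (hT : ∀ v, ‖T v‖ ≤ ‖v‖)
    (E : X →ₗ[ℝ] P) (F : Z →ₗ[ℝ] P)
    (hinj : ∀ x z, S x = 0 → T z = 0 → E x + F z = 0 → x = 0 ∧ z = 0) {μ cf cg : ℝ}
    (hμ : 0 < μ) (hcf : 0 < cf) (hcg : 0 < cg) :
    ∃ κ : ℝ, 0 < κ ∧ IsDissipationBound S T E F μ cf cg κ := by
  obtain ⟨κ, hκ, h⟩ := exists_mul_add_sq_norm_le S T E F hinj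
  -- the weight `b` is small enough for the mismatch term to absorb its share of `‖T z‖ ^ 2`
  set b : ℝ := min (min cf (1 / μ)) (min (cg / 2) (1 / (4 * μ)))
  have hb : 0 < b := by positivity
  have hb1 : b ≤ cf := (min_le_left _ _).trans (min_le_left _ _)
  have hb2 : b ≤ 1 / μ := (min_le_left _ _).trans (min_le_right _ _)
  have hb3 : b ≤ cg / 2 := (min_le_right _ _).trans (min_le_left _ _)
  have hb4 : b ≤ 1 / (4 * μ) := (min_le_right _ _).trans (min_le_right _ _)
  refine ⟨min (κ * b) (μ / 2), by positivity, fun x A z y d hA hd => ?_⟩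
  set p := z + μ • (y - d)
  have h1 : ‖T z‖ ^ 2 ≤ 2 * ‖T p‖ ^ 2 + 2 * μ ^ 2 * ‖d - y‖ ^ 2 := by
    have e : z = p + μ • (d - y) := by
      simp only [p, smul_sub]; abel
    have h2 : ‖T z‖ ≤ ‖T p‖ + μ * ‖d - y‖ := by
      calc ‖T z‖ = ‖T p + μ • T (d - y)‖ := by rw [e, map_add, map_smul]
        _ ≤ ‖T p‖ + ‖μ • T (d - y)‖ := norm_add_le _ _
        _ ≤ _ := by
          rw [norm_smul, Real.norm_of_nonneg hμ.le]
          gcongr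
          exact hT _
    have h3 := pow_le_pow_left₀ (norm_nonneg _) h2 2
    nlinarith [sq_nonneg (‖T p‖ - μ * ‖d - y‖)]
  have h2 := h x z
  have h3 : b * ‖S x‖ ^ 2 ≤ cf * ‖S x‖ ^ 2 := by gcongr
  have h4 : b * ‖E x + F z‖ ^ 2 ≤ 1 / μ * ‖E x + F z‖ ^ 2 := by gcongr
  have h5 : b * ‖T p‖ ^ 2 ≤ cg / 2 * ‖T p‖ ^ 2 := by gcongr
  have h6 : b * (2 * μ ^ 2 * ‖d - y‖ ^ 2) ≤ 1 / (4 * μ) * (2 * μ ^ 2 * ‖d - y‖ ^ 2) := by gcongr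
  have h7 : 1 / (4 * μ) * (2 * μ ^ 2 * ‖d - y‖ ^ 2) = μ / 2 * ‖d - y‖ ^ 2 := by
    field_simp; ring
  have h8 : b * ‖T z‖ ^ 2 ≤ b * (2 * ‖T p‖ ^ 2 + 2 * μ ^ 2 * ‖d - y‖ ^ 2) := by gcongr
  have h9 : min (κ * b) (μ / 2) * (‖x‖ ^ 2 + ‖z‖ ^ 2) ≤ κ * b * (‖x‖ ^ 2 + ‖z‖ ^ 2) := by
    gcongr; exact min_le_left _ _
  have h10 : min (κ * b) (μ / 2) * ‖d - y‖ ^ 2 ≤ μ / 2 * ‖d - y‖ ^ 2 := by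
    gcongr; exact min_le_right _ _
  have h11 : κ * b * (‖x‖ ^ 2 + ‖z‖ ^ 2) ≤
      b * (‖S x‖ ^ 2 + ‖T z‖ ^ 2 + ‖E x + F z‖ ^ 2) := by
    have := mul_le_mul_of_nonneg_left h2 hb.le
    linarith
  linarith

end Coercivity

/-! ### The Lyapunov function -/

lemma le_mul_exp_of_hasDerivWithinAt_le {V V' : ℝ → ℝ} {ρ t₀ : ℝ}
    (hV : ∀ t, t₀ ≤ t → HasDerivWithinAt V (V' t) (Set.Ici t₀) t)
    (hle : ∀ t, t₀ ≤ t → V' t ≤ -ρ * V t) {t : ℝ} (ht : t₀ ≤ t) :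
    V t ≤ V t₀ * Real.exp (-ρ * (t - t₀)) := by
  have hexp : ∀ s, HasDerivAt (fun s => Real.exp (ρ * (s - t₀)))
      (Real.exp (ρ * (s - t₀)) * ρ) s := fun s => by
    have := (((hasDerivAt_id s).sub_const t₀).const_mul ρ).exp
    simpa using this
  have hder : ∀ s, t₀ ≤ s → HasDerivWithinAt (fun s => V s * Real.exp (ρ * (s - t₀)))
      (V' s * Real.exp (ρ * (s - t₀)) + V s * (Real.exp (ρ * (s - t₀)) * ρ)) (Set.Ici t₀) s :=
    fun s hs => (hV s hs).mul (hexp s).hasDerivWithinAt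
  have hanti := antitoneOn_of_hasDerivWithinAt_nonpos (convex_Ici t₀)
    (fun s hs => (hder s hs).continuousWithinAt)
    (fun s hs => (hder s (interior_subset hs)).mono interior_subset) (fun s hs => by
      have h1 := hle s (interior_subset hs)
      have h2 := Real.exp_pos (ρ * (s - t₀))
      have : V' s * Real.exp (ρ * (s - t₀)) + V s * (Real.exp (ρ * (s - t₀)) * ρ) =
        (V' s + ρ * V s) * Real.exp (ρ * (s - t₀)) := by ring
      rw [this]
      exact mul_nonpos_of_nonpos_of_nonneg (by linarith) h2.le)
  have h := hanti (Set.self_mem_Ici) ht ht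
  simp only [sub_self, mul_zero, Real.exp_zero, mul_one] at h
  have e : V t = V t * Real.exp (ρ * (t - t₀)) * Real.exp (-ρ * (t - t₀)) := by
    rw [mul_assoc, ← Real.exp_add]; simp
  rw [e]
  exact mul_le_mul_of_nonneg_right h (Real.exp_pos _).le

section Lyapunov

variable {X Z P : Type} [NormedAddCommGroup X] [InnerProductSpace ℝ X] [NormedAddCommGroup Z]
  [InnerProductSpace ℝ Z] [NormedAddCommGroup P] [InnerProductSpace ℝ P]

/-- The Lyapunov function: the quadratic energy, whose derivative does not control `λ` and `y`,
and small multiples of two cross terms, which make them dissipate. -/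
noncomputable def lyapunov (E : X →ₗ[ℝ] P) (α ε₁ ε₂ : ℝ) (x : X) (z y : Z) (lam : P) : ℝ :=
  1 / 2 * (‖x‖ ^ 2 + ‖z‖ ^ 2) + 1 / (2 * α) * (‖y‖ ^ 2 + ‖lam‖ ^ 2)
    + ε₁ * ⟪E x, lam⟫_ℝ + ε₂ * ⟪z, y⟫_ℝ

lemma exists_norm_map_le {V W : Type} [NormedAddCommGroup V] [NormedSpace ℝ V]
    [FiniteDimensional ℝ V] [NormedAddCommGroup W] [NormedSpace ℝ W] (A : V →ₗ[ℝ] W) :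
    ∃ B : ℝ, 0 ≤ B ∧ ∀ x, ‖A x‖ ≤ B * ‖x‖ :=
  ⟨‖A.toContinuousLinearMap‖, norm_nonneg _, A.toContinuousLinearMap.le_opNorm⟩

/-- The derivative of the cross term `⟨E x, λ⟩` along the flow. -/
lemma cross_primal_dual_le [FiniteDimensional ℝ X] [FiniteDimensional ℝ P] {E : X →ₗ[ℝ] P} {F : Z →ₗ[ℝ] P} {B L μ α : ℝ} (hμ : 0 < μ)
    (hα : 0 < α) (hB : 0 ≤ B) (hL : 0 ≤ L) (hE : ∀ x, ‖E x‖ ≤ B * ‖x‖)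
    (hF : ∀ z, ‖F z‖ ≤ B * ‖z‖) (hE' : ∀ w, ‖adjoint E w‖ ≤ B * ‖w‖)
    (x A : X) (z : Z) (lam : P) (hA : ‖A‖ ≤ L * ‖x‖) :
    ⟪-A - adjoint E ((1 / μ) • (E x + F z) + lam), adjoint E lam⟫_ℝ
      + α * ⟪E x, E x + F z⟫_ℝ ≤
      -(1 / 2) * ‖adjoint E lam‖ ^ 2
        + ((L + B ^ 2 / μ) ^ 2 + 2 * α * B ^ 2) * (‖x‖ ^ 2 + ‖z‖ ^ 2) := by
  set r := E x + F z
  have hr : ‖r‖ ≤ B * (‖x‖ + ‖z‖) := by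
    calc ‖r‖ ≤ ‖E x‖ + ‖F z‖ := norm_add_le _ _
      _ ≤ _ := by linarith [hE x, hF z]
  set K := L + B ^ 2 / μ
  have hK : 0 ≤ K := by positivity
  have hu : ‖A + (1 / μ) • adjoint E r‖ ≤ K * (‖x‖ + ‖z‖) := by
    calc ‖A + (1 / μ) • adjoint E r‖ ≤ ‖A‖ + ‖(1 / μ) • adjoint E r‖ := norm_add_le _ _
      _ ≤ L * ‖x‖ + 1 / μ * (B * (B * (‖x‖ + ‖z‖))) := by
        rw [norm_smul, Real.norm_of_nonneg (by positivity)]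
        gcongr
        exact (hE' r).trans (by gcongr)
      _ ≤ L * (‖x‖ + ‖z‖) + 1 / μ * (B * (B * (‖x‖ + ‖z‖))) := by
        gcongr; linarith [norm_nonneg z]
      _ = K * (‖x‖ + ‖z‖) := by simp only [K]; field_simp
  have e : ⟪-A - adjoint E ((1 / μ) • r + lam), adjoint E lam⟫_ℝ =
      - ⟪A + (1 / μ) • adjoint E r, adjoint E lam⟫_ℝ - ‖adjoint E lam‖ ^ 2 := by
    rw [map_add, map_smul, ← real_inner_self_eq_norm_sq, ← inner_neg_left, ← inner_sub_left]
    congr 1; abel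
  have h1 := (abs_le.mp (abs_real_inner_le_norm (A + (1 / μ) • adjoint E r) (adjoint E lam))).1
  have h2 := real_inner_le_norm (E x) r
  have hs : (‖x‖ + ‖z‖) ^ 2 ≤ 2 * (‖x‖ ^ 2 + ‖z‖ ^ 2) := by
    nlinarith [sq_nonneg (‖x‖ - ‖z‖)]
  have h3 : ‖A + (1 / μ) • adjoint E r‖ * ‖adjoint E lam‖ ≤
      1 / 2 * ‖adjoint E lam‖ ^ 2 + K ^ 2 * (‖x‖ ^ 2 + ‖z‖ ^ 2) := by
    have h4 := mul_le_mul_of_nonneg_right hu (norm_nonneg (adjoint E lam))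
    have h5 := mul_le_mul_of_nonneg_left hs (sq_nonneg K)
    nlinarith [sq_nonneg (‖adjoint E lam‖ - K * (‖x‖ + ‖z‖))]
  have h6 : ‖E x‖ * ‖r‖ ≤ 2 * B ^ 2 * (‖x‖ ^ 2 + ‖z‖ ^ 2) := by
    have h7 : ‖E x‖ ≤ B * (‖x‖ + ‖z‖) :=
      (hE x).trans (by gcongr; linarith [norm_nonneg z])
    calc ‖E x‖ * ‖r‖ ≤ (B * (‖x‖ + ‖z‖)) * (B * (‖x‖ + ‖z‖)) := by gcongr
      _ = B ^ 2 * (‖x‖ + ‖z‖) ^ 2 := by ring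
      _ ≤ B ^ 2 * (2 * (‖x‖ ^ 2 + ‖z‖ ^ 2)) := by gcongr
      _ = _ := by ring
  have h8 : α * ⟪E x, r⟫_ℝ ≤ α * (2 * B ^ 2 * (‖x‖ ^ 2 + ‖z‖ ^ 2)) := by
    gcongr; exact h2.trans h6
  rw [e]
  linarith

/-- The derivative of the cross term `⟨z, y⟩` along the flow. -/
lemma cross_nonsmooth_le [FiniteDimensional ℝ Z] [FiniteDimensional ℝ P] {E : X →ₗ[ℝ] P} {F : Z →ₗ[ℝ] P} {B μ α : ℝ} (hμ : 0 < μ)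
    (hα : 0 < α) (hB : 0 ≤ B) (hE : ∀ x, ‖E x‖ ≤ B * ‖x‖) (hF : ∀ z, ‖F z‖ ≤ B * ‖z‖)
    (hF' : ∀ w, ‖adjoint F w‖ ≤ B * ‖w‖) (x : X) (z y d : Z) (lam : P) :
    ⟪-d - adjoint F ((1 / μ) • (E x + F z) + lam), y⟫_ℝ + α * μ * ⟪z, d - y⟫_ℝ ≤
      -(1 / 2) * ‖y‖ ^ 2 + (2 * (1 + B ^ 2 / μ + B) ^ 2 + α * μ)
        * (‖x‖ ^ 2 + ‖z‖ ^ 2 + ‖d - y‖ ^ 2 + ‖lam‖ ^ 2) := by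
  set r := E x + F z
  have hr : ‖r‖ ≤ B * (‖x‖ + ‖z‖) := by
    calc ‖r‖ ≤ ‖E x‖ + ‖F z‖ := norm_add_le _ _
      _ ≤ _ := by linarith [hE x, hF z]
  set K := 1 + B ^ 2 / μ + B
  have hK : 0 ≤ K := by positivity
  set w := (d - y) + adjoint F ((1 / μ) • r + lam)
  set s := ‖x‖ + ‖z‖ + ‖d - y‖ + ‖lam‖
  have hw : ‖w‖ ≤ K * s := by
    have hx := norm_nonneg x
    have hz := norm_nonneg z
    have hd := norm_nonneg (d - y)
    have hl := norm_nonneg lam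
    calc ‖w‖ ≤ ‖d - y‖ + ‖adjoint F ((1 / μ) • r + lam)‖ := norm_add_le _ _
      _ ≤ ‖d - y‖ + B * (1 / μ * (B * (‖x‖ + ‖z‖)) + ‖lam‖) := by
        gcongr
        refine (hF' _).trans ?_
        gcongr
        refine (norm_add_le _ _).trans ?_
        rw [norm_smul, Real.norm_of_nonneg (by positivity)]
        gcongr
      _ = 1 * ‖d - y‖ + B ^ 2 / μ * (‖x‖ + ‖z‖) + B * ‖lam‖ := by field_simp; ring
      _ ≤ 1 * s + B ^ 2 / μ * s + B * s := by
        gcongr <;> simp only [s] <;> linarith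
      _ = K * s := by simp only [K]; ring
  have e : ⟪-d - adjoint F ((1 / μ) • r + lam), y⟫_ℝ = - ⟪w, y⟫_ℝ - ‖y‖ ^ 2 := by
    rw [← real_inner_self_eq_norm_sq, ← inner_neg_left, ← inner_sub_left]
    congr 1; simp only [w]; abel
  have h1 := (abs_le.mp (abs_real_inner_le_norm w y)).1
  have h2 := real_inner_le_norm z (d - y)
  have hs : s ^ 2 ≤ 4 * (‖x‖ ^ 2 + ‖z‖ ^ 2 + ‖d - y‖ ^ 2 + ‖lam‖ ^ 2) := by
    simp only [s]
    nlinarith [sq_nonneg (‖x‖ - ‖z‖), sq_nonneg (‖x‖ - ‖d - y‖), sq_nonneg (‖x‖ - ‖lam‖),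
      sq_nonneg (‖z‖ - ‖d - y‖), sq_nonneg (‖z‖ - ‖lam‖), sq_nonneg (‖d - y‖ - ‖lam‖)]
  have h3 : ‖w‖ * ‖y‖ ≤
      1 / 2 * ‖y‖ ^ 2 + 2 * K ^ 2 * (‖x‖ ^ 2 + ‖z‖ ^ 2 + ‖d - y‖ ^ 2 + ‖lam‖ ^ 2) := by
    have h4 := mul_le_mul_of_nonneg_right hw (norm_nonneg y)
    have h5 := mul_le_mul_of_nonneg_left hs (sq_nonneg K)
    nlinarith [sq_nonneg (‖y‖ - K * s)]
  have h6 : ⟪z, d - y⟫_ℝ ≤ ‖x‖ ^ 2 + ‖z‖ ^ 2 + ‖d - y‖ ^ 2 + ‖lam‖ ^ 2 := by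
    nlinarith [sq_nonneg (‖z‖ - ‖d - y‖), sq_nonneg ‖x‖, sq_nonneg ‖z‖, sq_nonneg ‖d - y‖,
      sq_nonneg ‖lam‖]
  have h7 := mul_le_mul_of_nonneg_left h6 (by positivity : 0 ≤ α * μ)
  rw [e]
  linarith

end Lyapunov

/-! ### Exponential stability of the error system -/

section ErrorSystem

variable {X Z P : Type} [NormedAddCommGroup X] [InnerProductSpace ℝ X] [NormedAddCommGroup Z]
  [InnerProductSpace ℝ Z] [NormedAddCommGroup P] [InnerProductSpace ℝ P]

lemma abs_cross_le {E : X →ₗ[ℝ] P} {B α ε₁ ε₂ : ℝ} (hB : 0 ≤ B)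
    (hE : ∀ x, ‖E x‖ ≤ B * ‖x‖) (hε₁ : 0 < ε₁) (hε₂ : 0 < ε₂)
    (h1 : ε₁ * B ≤ 1 / 4) (h1' : ε₁ * B ≤ 1 / (4 * α)) (h2 : ε₂ ≤ 1 / 4) (h2' : ε₂ ≤ 1 / (4 * α))
    (x : X) (z y : Z) (lam : P) :
    |ε₁ * ⟪E x, lam⟫_ℝ + ε₂ * ⟪z, y⟫_ℝ| ≤
      1 / 4 * (‖x‖ ^ 2 + ‖z‖ ^ 2) + 1 / (4 * α) * (‖y‖ ^ 2 + ‖lam‖ ^ 2) := by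
  have amgm : ∀ c u v : ℝ, 0 ≤ c → 0 ≤ u → 0 ≤ v → c ≤ 1 / 4 → c ≤ 1 / (4 * α) →
      c * (u * v) ≤ 1 / 4 * u ^ 2 + 1 / (4 * α) * v ^ 2 := by
    intro c u v hc hu hv hc1 hc2
    have h3 : c * (u * v) ≤ c * u ^ 2 + c * v ^ 2 := by
      have : u * v ≤ u ^ 2 + v ^ 2 := by nlinarith [sq_nonneg (u - v)]
      nlinarith
    have h4 : c * u ^ 2 ≤ 1 / 4 * u ^ 2 := by gcongr
    have h5 : c * v ^ 2 ≤ 1 / (4 * α) * v ^ 2 := by gcongr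
    linarith
  have h3 : |ε₁ * ⟪E x, lam⟫_ℝ| ≤ ε₁ * B * (‖x‖ * ‖lam‖) := by
    rw [abs_mul, abs_of_pos hε₁, mul_assoc]
    refine mul_le_mul_of_nonneg_left ((abs_real_inner_le_norm _ _).trans ?_) hε₁.le
    rw [← mul_assoc]
    exact mul_le_mul_of_nonneg_right (hE x) (norm_nonneg _)
  have h4 : |ε₂ * ⟪z, y⟫_ℝ| ≤ ε₂ * (‖z‖ * ‖y‖) := by
    rw [abs_mul, abs_of_pos hε₂]
    exact mul_le_mul_of_nonneg_left (abs_real_inner_le_norm _ _) hε₂.le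
  have h5 := amgm (ε₁ * B) ‖x‖ ‖lam‖ (by positivity) (norm_nonneg _) (norm_nonneg _) h1 h1'
  have h6 := amgm ε₂ ‖z‖ ‖y‖ hε₂.le (norm_nonneg _) (norm_nonneg _) h2 h2'
  have h7 := abs_add_le (ε₁ * ⟪E x, lam⟫_ℝ) (ε₂ * ⟪z, y⟫_ℝ)
  linarith

/-- The quadratic energy has derivative minus the dissipation: the terms in which the primal errors
meet the multiplier error `λ` cancel. -/
lemma energy_deriv_eq [FiniteDimensional ℝ X] [FiniteDimensional ℝ Z] [FiniteDimensional ℝ P]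
    (E : X →ₗ[ℝ] P) (F : Z →ₗ[ℝ] P) {μ α : ℝ} (hα : α ≠ 0)
    (x A : X) (z y d : Z) (lam : P) :
    ⟪x, -A - adjoint E ((1 / μ) • (E x + F z) + lam)⟫_ℝ
      + ⟪z, -d - adjoint F ((1 / μ) • (E x + F z) + lam)⟫_ℝ
      + 1 / α * (⟪y, (α * μ) • (d - y)⟫_ℝ + ⟪lam, α • (E x + F z)⟫_ℝ) =
    -(⟪A, x⟫_ℝ + 1 / μ * ‖E x + F z‖ ^ 2 + ⟪d, z + μ • (y - d)⟫_ℝ + μ * ‖d - y‖ ^ 2) := by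
  have h1 : ⟪x, adjoint E ((1 / μ) • (E x + F z) + lam)⟫_ℝ
      + ⟪z, adjoint F ((1 / μ) • (E x + F z) + lam)⟫_ℝ =
      1 / μ * ‖E x + F z‖ ^ 2 + ⟪lam, E x + F z⟫_ℝ := by
    rw [LinearMap.adjoint_inner_right, LinearMap.adjoint_inner_right, ← inner_add_left,
      inner_add_right, real_inner_smul_right, real_inner_self_eq_norm_sq, real_inner_comm lam]
  have h2 : ‖d - y‖ ^ 2 = ⟪d, d⟫_ℝ - 2 * ⟪d, y⟫_ℝ + ⟪y, y⟫_ℝ := by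
    rw [norm_sub_sq_real, real_inner_self_eq_norm_sq, real_inner_self_eq_norm_sq]
  have h3 : 1 / α * (⟪y, (α * μ) • (d - y)⟫_ℝ + ⟪lam, α • (E x + F z)⟫_ℝ) =
      μ * ⟪y, d - y⟫_ℝ + ⟪lam, E x + F z⟫_ℝ := by
    rw [real_inner_smul_right, real_inner_smul_right]
    field_simp
  have h4 : ⟪d, z + μ • (y - d)⟫_ℝ = ⟪d, z⟫_ℝ + μ * (⟪d, y⟫_ℝ - ⟪d, d⟫_ℝ) := by
    rw [inner_add_right, real_inner_smul_right, inner_sub_right]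
  rw [h3, h2, h4, inner_sub_right x, inner_sub_right z, inner_sub_right y, inner_neg_right,
    inner_neg_right, real_inner_comm A x, real_inner_comm d z, real_inner_comm d y]
  linarith

lemma hasDerivWithinAt_lyapunov [FiniteDimensional ℝ X] [FiniteDimensional ℝ P] (E : X →ₗ[ℝ] P) {α ε₁ ε₂ : ℝ}
    {x : ℝ → X} {z y : ℝ → Z} {lam : ℝ → P} {x' : X} {z' y' : Z} {lam' : P} {s : Set ℝ} {t : ℝ}
    (hx : HasDerivWithinAt x x' s t) (hz : HasDerivWithinAt z z' s t)
    (hy : HasDerivWithinAt y y' s t) (hlam : HasDerivWithinAt lam lam' s t) :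
    HasDerivWithinAt (fun t => lyapunov E α ε₁ ε₂ (x t) (z t) (y t) (lam t))
      (⟪x t, x'⟫_ℝ + ⟪z t, z'⟫_ℝ + 1 / α * (⟪y t, y'⟫_ℝ + ⟪lam t, lam'⟫_ℝ)
        + ε₁ * (⟪x', adjoint E (lam t)⟫_ℝ + ⟪E (x t), lam'⟫_ℝ)
        + ε₂ * (⟪z', y t⟫_ℝ + ⟪z t, y'⟫_ℝ)) s t := by
  have hEx : HasDerivWithinAt (fun t => E (x t)) (E x') s t :=
    (E.toContinuousLinearMap.hasFDerivAt (x := x t)).comp_hasDerivWithinAt t hx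
  have h := ((((hx.norm_sq).add hz.norm_sq).const_mul (1 / 2)).add
    ((hy.norm_sq.add hlam.norm_sq).const_mul (1 / (2 * α)))).add
    ((hEx.inner ℝ hlam).const_mul ε₁) |>.add ((hz.inner ℝ hy).const_mul ε₂)
  refine h.congr_deriv ?_
  rw [LinearMap.adjoint_inner_right]
  have e : 1 / α = 2 * (1 / (2 * α)) := by
    rw [one_div, one_div, mul_inv, ← mul_assoc, mul_inv_cancel₀ two_ne_zero, one_mul]
  rw [e]
  ring

variable [FiniteDimensional ℝ X] [FiniteDimensional ℝ Z] [FiniteDimensional ℝ P]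

/-- With the constants `M` and `ρ`, the error system decays exponentially in the squared norm.
Here `x, z, y, λ` are the deviations of a trajectory from an equilibrium, and `A` and `d` the
deviations of the gradients of the smooth part and of the Moreau envelope. The linear system is
driven by `A` and `d`, of which only a linear bound on `A` and the dissipation inequality are
required. -/
def IsExponentialBound (E : X →ₗ[ℝ] P) (F : Z →ₗ[ℝ] P) (μ α L κ M ρ : ℝ) : Prop :=
  ∀ (t₀ : ℝ) (x A : ℝ → X) (z y d : ℝ → Z) (lam : ℝ → P),
    (∀ t, t₀ ≤ t → HasDerivWithinAt x
      (-A t - adjoint E ((1 / μ) • (E (x t) + F (z t)) + lam t)) (Set.Ici t₀) t) →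
    (∀ t, t₀ ≤ t → HasDerivWithinAt z
      (-d t - adjoint F ((1 / μ) • (E (x t) + F (z t)) + lam t)) (Set.Ici t₀) t) →
    (∀ t, t₀ ≤ t → HasDerivWithinAt y ((α * μ) • (d t - y t)) (Set.Ici t₀) t) →
    (∀ t, t₀ ≤ t → HasDerivWithinAt lam (α • (E (x t) + F (z t))) (Set.Ici t₀) t) →
    (∀ t, t₀ ≤ t → ∀ w, adjoint E w = 0 → ⟪w, lam t⟫_ℝ = 0) →
    (∀ t, t₀ ≤ t → ‖A t‖ ≤ L * ‖x t‖) →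
    (∀ t, t₀ ≤ t → κ * (‖x t‖ ^ 2 + ‖z t‖ ^ 2 + ‖d t - y t‖ ^ 2) ≤
      ⟪A t, x t⟫_ℝ + 1 / μ * ‖E (x t) + F (z t)‖ ^ 2
        + ⟪d t, z t + μ • (y t - d t)⟫_ℝ + μ * ‖d t - y t‖ ^ 2) →
    ∀ t, t₀ ≤ t → ‖x t‖ ^ 2 + ‖z t‖ ^ 2 + ‖y t‖ ^ 2 + ‖lam t‖ ^ 2 ≤
      M * (‖x t₀‖ ^ 2 + ‖z t₀‖ ^ 2 + ‖y t₀‖ ^ 2 + ‖lam t₀‖ ^ 2) * Real.exp (-ρ * (t - t₀))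

/-- Exponential stability of the error system, for every `α > 0`, by means of the Lyapunov
function. -/
theorem exists_isExponentialBound (E : X →ₗ[ℝ] P) (F : Z →ₗ[ℝ] P) {μ α L κ : ℝ} (hμ : 0 < μ)
    (hα : 0 < α) (hL : 0 ≤ L) (hκ : 0 < κ) :
    ∃ M ρ : ℝ, 0 < M ∧ 0 < ρ ∧ IsExponentialBound E F μ α L κ M ρ := by
  obtain ⟨σ, hσ, hσle⟩ := exists_mul_sq_norm_le_of_orthogonal_ker (adjoint E)
  obtain ⟨B₁, hB₁, hE₁⟩ := exists_norm_map_le E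
  obtain ⟨B₂, hB₂, hF₁⟩ := exists_norm_map_le F
  obtain ⟨B₃, hB₃, hE'₁⟩ := exists_norm_map_le (adjoint E)
  obtain ⟨B₄, hB₄, hF'₁⟩ := exists_norm_map_le (adjoint F)
  set B := B₁ + B₂ + B₃ + B₄ + 1
  have hB : 0 < B := by positivity
  have hE : ∀ x, ‖E x‖ ≤ B * ‖x‖ := fun x =>
    (hE₁ x).trans (by gcongr; simp only [B]; linarith)
  have hF : ∀ x, ‖F x‖ ≤ B * ‖x‖ := fun x =>
    (hF₁ x).trans (by gcongr; simp only [B]; linarith)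
  have hE' : ∀ x, ‖adjoint E x‖ ≤ B * ‖x‖ := fun x =>
    (hE'₁ x).trans (by gcongr; simp only [B]; linarith)
  have hF' : ∀ x, ‖adjoint F x‖ ≤ B * ‖x‖ := fun x =>
    (hF'₁ x).trans (by gcongr; simp only [B]; linarith)
  set C₁ := (L + B ^ 2 / μ) ^ 2 + 2 * α * B ^ 2
  have hC₁ : 0 < C₁ := by positivity
  set C₂ := 2 * (1 + B ^ 2 / μ + B) ^ 2 + α * μ
  have hC₂ : 0 < C₂ := by positivity
  set c₀ := min (1 / 4) (1 / (4 * α))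
  have hc₀ : 0 < c₀ := by positivity
  -- `ε₂ ≪ ε₁ ≪ 1`: the error terms of each cross term are absorbed by the dissipation so far
  set ε₁ := min (κ / (4 * C₁)) (c₀ / B)
  have hε₁ : 0 < ε₁ := by positivity
  set ε₂ := min (min (κ / (4 * C₂)) (ε₁ * σ / (4 * C₂))) c₀
  have hε₂ : 0 < ε₂ := by positivity
  have hε₁C : ε₁ * C₁ ≤ κ / 4 := by
    have : ε₁ ≤ κ / (4 * C₁) := min_le_left _ _
    rw [le_div_iff₀ (by positivity)] at this
    linarith
  have hε₁B : ε₁ * B ≤ c₀ := by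
    have : ε₁ ≤ c₀ / B := min_le_right _ _
    rwa [le_div_iff₀ hB] at this
  have hε₂C : ε₂ * C₂ ≤ κ / 4 := by
    have : ε₂ ≤ κ / (4 * C₂) := (min_le_left _ _).trans (min_le_left _ _)
    rw [le_div_iff₀ (by positivity)] at this
    linarith
  have hε₂C' : ε₂ * C₂ ≤ ε₁ * σ / 4 := by
    have : ε₂ ≤ ε₁ * σ / (4 * C₂) := (min_le_left _ _).trans (min_le_right _ _)
    rw [le_div_iff₀ (by positivity)] at this
    linarith
  have hε₂c : ε₂ ≤ c₀ := min_le_right _ _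
  have hcl : c₀ ≤ 1 / 4 := min_le_left _ _
  have hcr : c₀ ≤ 1 / (4 * α) := min_le_right _ _
  set δ := min (κ / 2) (min (ε₁ * σ / 4) (ε₂ / 2))
  have hδ : 0 < δ := by positivity
  have hδ1 : δ ≤ κ / 2 := min_le_left _ _
  have hδ2 : δ ≤ ε₁ * σ / 4 := (min_le_right _ _).trans (min_le_left _ _)
  have hδ3 : δ ≤ ε₂ / 2 := (min_le_right _ _).trans (min_le_right _ _)
  set c₁ := 1 + 1 / α
  have hc₁ : 0 < c₁ := by positivity
  have hlow : ∀ (x : X) (z y : Z) (lam : P), c₀ * (‖x‖ ^ 2 + ‖z‖ ^ 2 + ‖y‖ ^ 2 + ‖lam‖ ^ 2) ≤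
      lyapunov E α ε₁ ε₂ x z y lam := by
    intro x z y lam
    have h := (abs_le.mp (abs_cross_le hB.le hE hε₁ hε₂ (hε₁B.trans hcl) (hε₁B.trans hcr)
      (hε₂c.trans hcl) (hε₂c.trans hcr) x z y lam)).1
    have h1 : c₀ * (‖x‖ ^ 2 + ‖z‖ ^ 2) ≤ 1 / 4 * (‖x‖ ^ 2 + ‖z‖ ^ 2) := by gcongr
    have h2 : c₀ * (‖y‖ ^ 2 + ‖lam‖ ^ 2) ≤ 1 / (4 * α) * (‖y‖ ^ 2 + ‖lam‖ ^ 2) := by gcongr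
    have e : 1 / (2 * α) = 2 * (1 / (4 * α)) := by field_simp; norm_num
    rw [lyapunov, e]
    linarith
  have hup : ∀ (x : X) (z y : Z) (lam : P), lyapunov E α ε₁ ε₂ x z y lam ≤
      c₁ * (‖x‖ ^ 2 + ‖z‖ ^ 2 + ‖y‖ ^ 2 + ‖lam‖ ^ 2) := by
    intro x z y lam
    have h := (abs_le.mp (abs_cross_le hB.le hE hε₁ hε₂ (hε₁B.trans hcl) (hε₁B.trans hcr)
      (hε₂c.trans hcl) (hε₂c.trans hcr) x z y lam)).2
    have e1 : 1 / (2 * α) = 1 / 2 * (1 / α) := by field_simp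
    have e2 : 1 / (4 * α) = 1 / 4 * (1 / α) := by field_simp
    have h1 : 0 ≤ 1 / α * (‖x‖ ^ 2 + ‖z‖ ^ 2) := by positivity
    have h2 : 0 ≤ 1 / α * (‖y‖ ^ 2 + ‖lam‖ ^ 2) := by positivity
    have h3 : 0 ≤ ‖x‖ ^ 2 + ‖z‖ ^ 2 := by positivity
    have h4 : 0 ≤ ‖y‖ ^ 2 + ‖lam‖ ^ 2 := by positivity
    rw [e2] at h
    rw [lyapunov, e1]
    simp only [c₁]
    linarith
  refine ⟨c₁ / c₀, δ / c₁, by positivity, by positivity, ?_⟩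
  intro t₀ x A z y d lam hx hz hy hlam hker hA hdiss t ht
  have hder := fun s hs => hasDerivWithinAt_lyapunov E (α := α) (ε₁ := ε₁) (ε₂ := ε₂)
    (hx s hs) (hz s hs) (hy s hs) (hlam s hs)
  have hV := le_mul_exp_of_hasDerivWithinAt_le (ρ := δ / c₁) hder (by
    intro s hs
    rw [energy_deriv_eq E F hα.ne']
    have h1 := hdiss s hs
    have h2 := cross_primal_dual_le hμ hα hB.le hL hE hF hE' (x s) (A s) (z s) (lam s) (hA s hs)
    have h3 := cross_nonsmooth_le hμ hα hB.le hE hF hF' (x s) (z s) (y s) (d s) (lam s)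
    have h4 := hσle (lam s) (hker s hs)
    have h5 := hup (x s) (z s) (y s) (lam s)
    rw [real_inner_smul_right, real_inner_smul_right]
    have h2' := mul_le_mul_of_nonneg_left h2 hε₁.le
    have h3' := mul_le_mul_of_nonneg_left h3 hε₂.le
    have h4' := mul_le_mul_of_nonneg_left h4 hε₁.le
    have h5' : δ / c₁ * lyapunov E α ε₁ ε₂ (x s) (z s) (y s) (lam s) ≤
        δ * (‖x s‖ ^ 2 + ‖z s‖ ^ 2 + ‖y s‖ ^ 2 + ‖lam s‖ ^ 2) := by
      rw [div_mul_eq_mul_div, div_le_iff₀ hc₁, mul_assoc]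
      refine mul_le_mul_of_nonneg_left (h5.trans (le_of_eq (mul_comm _ _))) hδ.le
    set N := ‖x s‖ ^ 2 + ‖z s‖ ^ 2
    set D := ‖d s - y s‖ ^ 2
    set Λ := ‖lam s‖ ^ 2
    set Y := ‖y s‖ ^ 2
    have hN : 0 ≤ N := by positivity
    have hD : 0 ≤ D := by positivity
    have hΛ : 0 ≤ Λ := by positivity
    have hY : 0 ≤ Y := by positivity
    have i1 : ε₁ * C₁ * N ≤ κ / 4 * N := by gcongr
    have i2 : ε₂ * C₂ * (N + D) ≤ κ / 4 * (N + D) := by gcongr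
    have i3 : ε₂ * C₂ * Λ ≤ ε₁ * σ / 4 * Λ := by gcongr
    have i4 : δ * N ≤ κ / 2 * N := by gcongr
    have i5 : δ * Λ ≤ ε₁ * σ / 4 * Λ := by gcongr
    have i6 : δ * Y ≤ ε₂ / 2 * Y := by gcongr
    have i7 : 0 ≤ κ * D := by positivity
    linarith) ht
  have h1 := (hlow (x t) (z t) (y t) (lam t)).trans hV
  have h2 := mul_le_mul_of_nonneg_right (hup (x t₀) (z t₀) (y t₀) (lam t₀))
    (Real.exp_pos (-(δ / c₁) * (t - t₀))).le
  have h3 := h1.trans h2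
  rw [mul_comm, ← le_div_iff₀ hc₀] at h3
  refine h3.trans (le_of_eq ?_)
  field_simp

end ErrorSystem

/-! ### Existence and structure of the Karush-Kuhn-Tucker points -/

lemma le_deriv_of_forall_le {h : ℝ → ℝ} {D K C : ℝ} (hh : HasDerivAt h D 0)
    (hle : ∀ t : ℝ, 0 < t → t < 1 → h 0 + K * t - C * t ^ 2 ≤ h t) : K ≤ D := by
  have h1 := hh.tendsto_slope_zero_right
  have h2 : Filter.Tendsto (fun t : ℝ => K - C * t) (nhdsWithin 0 (Set.Ioi 0)) (nhds K) := by
    have : Filter.Tendsto (fun t : ℝ => K - C * t) (nhds 0) (nhds (K - C * 0)) :=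
      Continuous.tendsto (by fun_prop) 0
    rw [mul_zero, sub_zero] at this
    exact this.mono_left nhdsWithin_le_nhds
  refine le_of_tendsto_of_tendsto h2 h1 ?_
  filter_upwards [Ioo_mem_nhdsGT (show (0 : ℝ) < 1 by norm_num)] with t ht
  have h3 := hle t ht.1 ht.2
  rw [smul_eq_mul, zero_add, inv_mul_eq_div, le_div_iff₀ ht.1]
  linarith

section

variable {X X' : Type} [NormedAddCommGroup X] [InnerProductSpace ℝ X] [NormedAddCommGroup X']
  [InnerProductSpace ℝ X']

/-- Convexity of a real function with the additional term `-(c/2) a b ‖S (u - v)‖²` in the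
convexity inequality. -/
def StrongConvexAlong (c : ℝ) (S : X →ₗ[ℝ] X') (f : X → ℝ) : Prop :=
  ∀ (u v : X) (a b : ℝ), 0 ≤ a → 0 ≤ b → a + b = 1 →
    f (a • u + b • v) ≤ a * f u + b * f v - c / 2 * (a * b) * ‖S (u - v)‖ ^ 2

variable [CompleteSpace X] {c : ℝ} {S : X →ₗ[ℝ] X'} {f : X → ℝ} {f' : X → X}

lemma hasDerivAt_line {x d v : X} (hf : HasGradientAt f d x) :
    HasDerivAt (fun t : ℝ => f (x + t • v)) ⟪d, v⟫_ℝ 0 := by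
  have h1 : HasDerivAt (fun t : ℝ => x + t • v) v 0 := by
    simpa using ((hasDerivAt_id (0 : ℝ)).smul_const v).const_add x
  have h2 : HasFDerivAt f (InnerProductSpace.toDual ℝ X d) (x + (0 : ℝ) • v) := by
    simpa using hf.hasFDerivAt
  exact h2.comp_hasDerivAt (0 : ℝ) h1

lemma StrongConvexAlong.add_inner_le (h : StrongConvexAlong c S f)
    (hf : ∀ x, HasGradientAt f (f' x) x) (x u : X) :
    f x + ⟪f' x, u - x⟫_ℝ + c / 2 * ‖S (u - x)‖ ^ 2 ≤ f u := by
  have h1 := (hasDerivAt_line (v := u - x) (hf x)).neg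
  have h2 := le_deriv_of_forall_le (K := f x - f u + c / 2 * ‖S (u - x)‖ ^ 2)
    (C := c / 2 * ‖S (u - x)‖ ^ 2) h1 (by
      intro t ht0 ht1
      have h3 := h u x t (1 - t) ht0.le (by linarith) (by ring)
      have e : t • u + (1 - t) • x = x + t • (u - x) := by
        rw [smul_sub, sub_smul, one_smul]; abel
      rw [e] at h3
      simp only [Pi.neg_apply, zero_smul, add_zero]
      linarith)
  linarith

lemma StrongConvexAlong.le_inner (h : StrongConvexAlong c S f)
    (hf : ∀ x, HasGradientAt f (f' x) x) (x u : X) :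
    c * ‖S (x - u)‖ ^ 2 ≤ ⟪f' x - f' u, x - u⟫_ℝ := by
  have h1 := h.add_inner_le hf x u
  have h2 := h.add_inner_le hf u x
  rw [← neg_sub x u, map_neg, norm_neg, inner_neg_right] at h1
  rw [inner_sub_left]
  linarith

end

section KKT

variable {X X' Z Z' P : Type} [NormedAddCommGroup X] [InnerProductSpace ℝ X]
  [FiniteDimensional ℝ X] [NormedAddCommGroup Z] [InnerProductSpace ℝ Z] [FiniteDimensional ℝ Z]
  [NormedAddCommGroup P] [InnerProductSpace ℝ P] [NormedAddCommGroup X'] [InnerProductSpace ℝ X']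
  [NormedAddCommGroup Z'] [InnerProductSpace ℝ Z']

/-- The optimality conditions of `min f(x) + g(z)` subject to `E x + F z = q`. Here `f'` stands
for the gradient of `f` and `y` is the subgradient of `g` at `z`, in terms of the Moreau
envelope. -/
structure IsKKT [FiniteDimensional ℝ P] (E : X →ₗ[ℝ] P) (F : Z →ₗ[ℝ] P) (q : P) (f' : X → X) (μ : ℝ) (g : Z → EReal)
    (x : X) (z y : Z) (lam : P) : Prop where
  stationary_x : f' x + adjoint E lam = 0
  stationary_z : y + adjoint F lam = 0
  moreauGrad_eq : moreauGrad μ g (z + μ • y) = y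
  feasible : E x + F z = q

variable {E : X →ₗ[ℝ] P} {F : Z →ₗ[ℝ] P} {q : P} {f : X → ℝ} {f' : X → X} {g : Z → EReal}
  {cf cg μ : ℝ} {S : X →ₗ[ℝ] X'} {T : Z →ₗ[ℝ] Z'}

lemma adjoint_eq_zero_of_range_le [FiniteDimensional ℝ P]
    (hrange : LinearMap.range F ≤ LinearMap.range E) {w : P}
    (hw : adjoint E w = 0) : adjoint F w = 0 := by
  refine ext_inner_right ℝ fun v => ?_
  obtain ⟨u, hu⟩ := hrange ⟨v, rfl⟩
  rw [LinearMap.adjoint_inner_left, ← hu, ← LinearMap.adjoint_inner_left, hw, inner_zero_left,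
    inner_zero_left]

/-- The constrained minimum is attained: `f(x) + g(z) + ½ ‖E x + F z - q‖²` is strongly convex, and
the quadratic term vanishes on the feasible set. -/
lemma exists_isMinOn_feasible [CompleteSpace X] (hf : ∀ x, HasGradientAt f (f' x) x)
    (hfc : StrongConvexAlong cf S f) (hg : ClosedStrongConvexAlong cg T g) (hcf : 0 < cf)
    (hcg : 0 < cg) (hinj : ∀ x z, S x = 0 → T z = 0 → E x + F z = 0 → x = 0 ∧ z = 0)
    {x₀ : X} {z₀ : Z} (hx₀ : E x₀ + F z₀ = q) (hz₀ : z₀ ∈ effDom g) :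
    ∃ x z, E x + F z = q ∧ z ∈ effDom g ∧ ∀ u w, E u + F w = q → w ∈ effDom g →
      f x + (g z).toReal ≤ f u + (g w).toReal := by
  have hproper : ProperSpace (X × Z) := FiniteDimensional.proper ℝ _
  obtain ⟨κ, hκ, hκle⟩ := exists_mul_add_sq_norm_le S T E F hinj
  have hfcont : Continuous f :=
    continuous_iff_continuousAt.mpr fun x => (hf x).hasFDerivAt.continuousAt
  have hEcont : Continuous E := E.continuous_of_finiteDimensional
  have hFcont : Continuous F := F.continuous_of_finiteDimensional
  set φ : X × Z → EReal := fun u =>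
    g u.2 + ((f u.1 + 1 / 2 * ‖E u.1 + F u.2 - q‖ ^ 2 : ℝ) : EReal)
  have hdom : ∀ u, u ∈ effDom φ → u.2 ∈ effDom g := by
    intro u hu
    by_contra hu'
    have : g u.2 = ⊤ := not_lt_top_iff.mp hu'
    have hφ : φ u = ⊤ := by simp only [φ, this, EReal.top_add_coe]
    exact absurd hu (by simp [effDom, hφ])
  have hφ : ∀ u : X × Z, u.2 ∈ effDom g → φ u =
      (((g u.2).toReal + (f u.1 + 1 / 2 * ‖E u.1 + F u.2 - q‖ ^ 2) : ℝ) : EReal) := by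
    intro u hu
    rw [EReal.coe_add, coe_toReal_of_mem_effDom hg.ne_bot hu]
  have hlsc : LowerSemicontinuous φ := by
    refine (LowerSemicontinuous.comp hg.lowerSemicontinuous continuous_snd).add' ?_
      fun u => EReal.continuousAt_add ?_ ?_
    · exact (continuous_coe_real_ereal.comp (by fun_prop)).lowerSemicontinuous
    · right; exact EReal.coe_ne_bot _
    · left; exact hg.ne_bot _
  set m : ℝ := min (min cf cg) 1
  have hm : 0 < m := by positivity
  have hm1 : m ≤ cf := (min_le_left _ _).trans (min_le_left _ _)
  have hm2 : m ≤ cg := (min_le_left _ _).trans (min_le_right _ _)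
  have hm3 : m ≤ 1 := min_le_right _ _
  have hconv : ∀ u ∈ effDom φ, ∀ v ∈ effDom φ, ∀ a b : ℝ, 0 ≤ a → 0 ≤ b → a + b = 1 →
      φ (a • u + b • v) ≤ ((a * (φ u).toReal + b * (φ v).toReal
        - m * κ / 2 * (a * b) * ‖u - v‖ ^ 2 : ℝ) : EReal) := by
    intro u hu v hv a b ha hb hab
    have hu' := hdom u hu
    have hv' := hdom v hv
    rw [hφ u hu', hφ v hv', hφ _ (hg.mem_effDom hu' hv' ha hb hab), EReal.toReal_coe,
      EReal.toReal_coe, EReal.coe_le_coe_iff]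
    have h1 := hg.toReal_le hu' hv' ha hb hab
    have h2 := hfc u.1 v.1 a b ha hb hab
    have e1 : E (a • u + b • v).1 + F (a • u + b • v).2 - q =
        a • (E u.1 + F u.2 - q) + b • (E v.1 + F v.2 - q) := by
      have : q = a • q + b • q := by rw [← add_smul, hab, one_smul]
      rw [Prod.fst_add, Prod.snd_add, Prod.smul_fst, Prod.smul_fst, Prod.smul_snd, Prod.smul_snd,
        map_add, map_add, map_smul, map_smul, map_smul, map_smul]
      nth_rewrite 1 [this]
      simp only [smul_sub, smul_add]
      abel
    have e2 : E u.1 + F u.2 - q - (E v.1 + F v.2 - q) = E (u.1 - v.1) + F (u.2 - v.2) := by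
      rw [map_sub, map_sub]; abel
    rw [e1, norm_combo_sq hab, e2]
    have h3 := hκle (u.1 - v.1) (u.2 - v.2)
    have h4 : ‖u - v‖ ^ 2 ≤ ‖u.1 - v.1‖ ^ 2 + ‖u.2 - v.2‖ ^ 2 := by
      rw [Prod.norm_def, Prod.fst_sub, Prod.snd_sub]
      have i1 := sq_nonneg ‖u.1 - v.1‖
      have i2 := sq_nonneg ‖u.2 - v.2‖
      rcases max_choice ‖u.1 - v.1‖ ‖u.2 - v.2‖ with h | h <;> rw [h] <;> linarith
    have h5 : m * κ * ‖u - v‖ ^ 2 ≤ cf * ‖S (u.1 - v.1)‖ ^ 2 + cg * ‖T (u.2 - v.2)‖ ^ 2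
        + 1 * ‖E (u.1 - v.1) + F (u.2 - v.2)‖ ^ 2 := by
      calc m * κ * ‖u - v‖ ^ 2 ≤ m * κ * (‖u.1 - v.1‖ ^ 2 + ‖u.2 - v.2‖ ^ 2) := by gcongr
        _ = m * (κ * (‖u.1 - v.1‖ ^ 2 + ‖u.2 - v.2‖ ^ 2)) := by ring
        _ ≤ m * (‖S (u.1 - v.1)‖ ^ 2 + ‖T (u.2 - v.2)‖ ^ 2
            + ‖E (u.1 - v.1) + F (u.2 - v.2)‖ ^ 2) := by gcongr
        _ = m * ‖S (u.1 - v.1)‖ ^ 2 + m * ‖T (u.2 - v.2)‖ ^ 2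
            + m * ‖E (u.1 - v.1) + F (u.2 - v.2)‖ ^ 2 := by ring
        _ ≤ _ := by gcongr
    have h6 := mul_le_mul_of_nonneg_left h5 (mul_nonneg ha hb)
    have e3 : (a • u + b • v).1 = a • u.1 + b • v.1 := rfl
    have e4 : (a • u + b • v).2 = a • u.2 + b • v.2 := rfl
    rw [e3, e4]
    linarith
  obtain ⟨w, hw, hmin⟩ := exists_isMinOn_of_strongConvex (φ := φ) (c := m * κ) (by positivity)
    (fun u => by
      simp only [φ, ne_eq, EReal.add_eq_bot_iff, hg.ne_bot u.2, EReal.coe_ne_bot, or_self,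
        not_false_eq_true]) hlsc hconv
    (C := {u : X × Z | E u.1 + F u.2 = q}) (isClosed_eq (by fun_prop) continuous_const)
    (z₀ := (x₀, z₀)) hx₀ (by
      change φ (x₀, z₀) < ⊤
      rw [hφ (x₀, z₀) hz₀]
      exact EReal.coe_lt_top _)
  have hwdom : w ∈ effDom φ := by
    refine lt_of_le_of_lt (isMinOn_iff.mp hmin (x₀, z₀) hx₀) ?_
    rw [hφ (x₀, z₀) hz₀]
    exact EReal.coe_lt_top _
  refine ⟨w.1, w.2, hw, hdom w hwdom, fun u v huv hv => ?_⟩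
  have h1 : φ w ≤ φ (u, v) := hmin huv
  have hw' : E w.1 + F w.2 = q := hw
  rw [hφ w (hdom w hwdom), hφ (u, v) hv, EReal.coe_le_coe_iff] at h1
  simp only [huv, hw', sub_self, norm_zero] at h1
  linarith

/-- Existence of multipliers. Because the range of `F` lies in that of `E`, every change of `z` can be
compensated by a change of `x`, and the first-order condition in these directions yields both
stationarity conditions; no separation theorem is needed. -/
lemma exists_isKKT [FiniteDimensional ℝ P] [CompleteSpace X] (hμ : 0 < μ) (hf : ∀ x, HasGradientAt f (f' x) x)
    (hfc : StrongConvexAlong cf S f) (hg : ClosedStrongConvexAlong cg T g) (hcf : 0 < cf)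
    (hcg : 0 < cg) (hinj : ∀ x z, S x = 0 → T z = 0 → E x + F z = 0 → x = 0 ∧ z = 0)
    (hrange : LinearMap.range F ≤ LinearMap.range E)
    {x₀ : X} {z₀ : Z} (hx₀ : E x₀ + F z₀ = q) (hz₀ : z₀ ∈ effDom g) :
    ∃ x z y lam, IsKKT E F q f' μ g x z y lam := by
  obtain ⟨x, z, hxz, hz, hmin⟩ := exists_isMinOn_feasible hf hfc hg hcf hcg hinj hx₀ hz₀
  have key : ∀ u ∈ effDom g, ∀ w, E w = F (u - z) →
      (g z).toReal - (g u).toReal ≤ ⟪f' x, -w⟫_ℝ := by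
    intro u hu w hw
    refine le_deriv_of_forall_le (C := cg / 2 * ‖T (u - z)‖ ^ 2)
      (hasDerivAt_line (v := -w) (hf x)) fun t ht0 ht1 => ?_
    have hfeas : E (x + t • -w) + F (t • u + (1 - t) • z) = q := by
      have e : t • u + (1 - t) • z = z + t • (u - z) := by
        rw [smul_sub, sub_smul, one_smul]; abel
      rw [e, map_add, map_add, map_smul, map_smul, map_neg, hw, ← hxz, smul_neg]
      abel
    have h1 := hmin _ _ hfeas (hg.mem_effDom hu hz ht0.le (by linarith : 0 ≤ 1 - t) (by ring))
    have h2 := hg.toReal_le hu hz ht0.le (by linarith : 0 ≤ 1 - t) (by ring)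
    have h3 : 0 ≤ cg / 2 * t * ‖T (u - z)‖ ^ 2 := by positivity
    simp only [zero_smul, add_zero]
    linarith
  have hperp : f' x ∈ E.kerᗮ := by
    intro w hw
    have hw' : E w = 0 := hw
    have h1 := key z hz w (by rw [hw', sub_self, map_zero])
    have h2 := key z hz (-w) (by rw [map_neg, hw', sub_self, map_zero, neg_zero])
    rw [sub_self, inner_neg_right] at h1
    rw [sub_self, neg_neg] at h2
    rw [real_inner_comm]
    linarith
  rw [LinearMap.orthogonal_ker] at hperp
  obtain ⟨ν, hν⟩ := hperp
  refine ⟨x, z, adjoint F ν, -ν, ?_, ?_, ?_, hxz⟩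
  · rw [map_neg, hν, add_neg_cancel]
  · rw [map_neg, add_neg_cancel]
  · have h1 : IsProx μ g (z + μ • adjoint F ν) z := by
      refine hg.isProx_of_subgradient hμ hz fun u hu => ?_
      obtain ⟨w, hw⟩ := hrange ⟨u - z, rfl⟩
      have h2 := key u hu w hw
      rw [← hν, LinearMap.adjoint_inner_left, map_neg, hw, inner_neg_right] at h2
      rw [LinearMap.adjoint_inner_left]
      linarith
    rw [moreauGrad, hg.prox_eq_of_isProx hcg.le hμ h1, add_sub_cancel_left, smul_smul,
      one_div_mul_cancel hμ.ne', one_smul]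

/-- Only the multiplier `λ` of a Karush-Kuhn-Tucker point is not unique, and it is determined up
to the kernel of the adjoint of `E`. -/
lemma IsKKT.iff [FiniteDimensional ℝ P] [CompleteSpace X] (hμ : 0 < μ) (hf : ∀ x, HasGradientAt f (f' x) x)
    (hfc : StrongConvexAlong cf S f) (hg : ClosedStrongConvexAlong cg T g) (hT : ∀ v, ‖T v‖ ≤ ‖v‖)
    (hcf : 0 < cf) (hcg : 0 < cg)
    (hinj : ∀ x z, S x = 0 → T z = 0 → E x + F z = 0 → x = 0 ∧ z = 0)
    (hrange : LinearMap.range F ≤ LinearMap.range E) {x : X} {z y : Z} {lam : P}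
    (h : IsKKT E F q f' μ g x z y lam) (x' : X) (z' y' : Z) (lam' : P) :
    IsKKT E F q f' μ g x' z' y' lam' ↔ x' = x ∧ z' = z ∧ y' = y ∧ adjoint E (lam' - lam) = 0 := by
  constructor
  · intro h'
    obtain ⟨κ, hκ, hκle⟩ := exists_isDissipationBound S T hT E F hinj hμ hcf hcg
    have hA := hfc.le_inner hf x' x
    have hd := hg.le_inner_moreauGrad hcg.le hμ (z' + μ • y') (z + μ • y)
    rw [h.moreauGrad_eq, h'.moreauGrad_eq] at hd
    have e : z' + μ • y' - (z + μ • y) - μ • (y' - y) =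
        (z' - z) + μ • ((y' - y) - (y' - y)) := by
      rw [sub_self, smul_zero, smul_sub]; abel
    rw [e] at hd
    have h1 := hκle _ _ _ _ _ hA hd
    have e1 : f' x' - f' x = -adjoint E (lam' - lam) := by
      rw [map_sub, eq_neg_of_add_eq_zero_left h.stationary_x,
        eq_neg_of_add_eq_zero_left h'.stationary_x]
      abel
    have e2 : y' - y = -adjoint F (lam' - lam) := by
      rw [map_sub, eq_neg_of_add_eq_zero_left h.stationary_z,
        eq_neg_of_add_eq_zero_left h'.stationary_z]
      abel
    have e3 : E (x' - x) + F (z' - z) = 0 := by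
      have := h'.feasible.trans h.feasible.symm
      rw [map_sub, map_sub]
      rw [← sub_eq_zero] at this
      rw [← this]; abel
    rw [sub_self (y' - y), smul_zero, add_zero, e3, norm_zero, e1, e2, inner_neg_left,
      inner_neg_left, LinearMap.adjoint_inner_left, LinearMap.adjoint_inner_left] at h1
    have e4 : ⟪lam' - lam, E (x' - x)⟫_ℝ + ⟪lam' - lam, F (z' - z)⟫_ℝ = 0 := by
      rw [← inner_add_right, e3, inner_zero_right]
    have h2 : κ * (‖x' - x‖ ^ 2 + ‖z' - z‖ ^ 2) ≤ κ * 0 := by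
      simp only [norm_zero] at h1
      linarith
    have h3 := le_of_mul_le_mul_left h2 hκ
    have hx : x' = x := by
      have : ‖x' - x‖ ^ 2 = 0 := by
        have := sq_nonneg ‖x' - x‖
        have := sq_nonneg ‖z' - z‖
        linarith
      exact sub_eq_zero.mp (norm_eq_zero.mp (pow_eq_zero_iff two_ne_zero |>.mp this))
    have hz : z' = z := by
      have : ‖z' - z‖ ^ 2 = 0 := by
        have := sq_nonneg ‖x' - x‖
        have := sq_nonneg ‖z' - z‖
        linarith
      exact sub_eq_zero.mp (norm_eq_zero.mp (pow_eq_zero_iff two_ne_zero |>.mp this))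
    have hlam : adjoint E (lam' - lam) = 0 := by
      rw [hx, sub_self] at e1
      exact neg_eq_zero.mp e1.symm
    refine ⟨hx, hz, ?_, hlam⟩
    rw [adjoint_eq_zero_of_range_le hrange hlam, neg_zero] at e2
    exact sub_eq_zero.mp e2
  · rintro ⟨rfl, rfl, rfl, hlam⟩
    have hlam' := adjoint_eq_zero_of_range_le hrange hlam
    rw [map_sub, sub_eq_zero] at hlam hlam'
    exact ⟨by rw [hlam]; exact h.stationary_x, by rw [hlam']; exact h.stationary_z,
      h.moreauGrad_eq, h.feasible⟩

end KKT

/-! ### Block structure -/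

section Restrict

variable {ι κ : Type} [Fintype ι] [Fintype κ]

/-- The linear map that reads off, from a vector indexed by `ι`, the coordinates `e k`. -/
noncomputable def restrictL (e : κ → ι) : EuclideanSpace ℝ ι →L[ℝ] EuclideanSpace ℝ κ :=
  LinearMap.toContinuousLinearMap
    { toFun := fun x => WithLp.toLp 2 fun k => x (e k)
      map_add' := fun _ _ => rfl
      map_smul' := fun _ _ => rfl }

lemma norm_sq_sum_eq (u : EuclideanSpace ℝ (ι ⊕ κ)) :
    ‖u‖ ^ 2 = ‖restrictL Sum.inl u‖ ^ 2 + ‖restrictL Sum.inr u‖ ^ 2 := by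
  rw [EuclideanSpace.norm_sq_eq, EuclideanSpace.norm_sq_eq, EuclideanSpace.norm_sq_eq,
    Fintype.sum_sum_type]
  rfl

end Restrict

section Blocks

variable {r : ℕ} {d : Fin r → ℕ}

lemma block_sub (x y : BlockVec d) (i : Fin r) : block (x - y) i = block x i - block y i := rfl

lemma block_combo (a b : ℝ) (x y : BlockVec d) (i : Fin r) :
    block (a • x + b • y) i = a • block x i + b • block y i := rfl

open scoped Classical in
/-- The projection onto the blocks outside `K`: the blocks in `K` are set to zero. -/
noncomputable def maskL (d : Fin r → ℕ) (K : Set (Fin r)) : BlockVec d →ₗ[ℝ] BlockVec d where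
  toFun x := WithLp.toLp 2 fun c => if c.1 ∈ K then 0 else x c
  map_add' x y := by
    ext c
    by_cases h : c.1 ∈ K <;> simp [h]
  map_smul' a x := by
    ext c
    by_cases h : c.1 ∈ K <;> simp [h]

lemma maskL_apply_of_notMem {K : Set (Fin r)} (x : BlockVec d) {c : BlockIndex d} (h : c.1 ∉ K) :
    maskL d K x c = x c := by
  simp [maskL, h]

open scoped Classical in
lemma norm_maskL_sq (K : Set (Fin r)) (x : BlockVec d) :
    ‖maskL d K x‖ ^ 2 = ∑ i, if i ∈ K then 0 else ‖block x i‖ ^ 2 := by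
  rw [EuclideanSpace.norm_sq_eq, Fintype.sum_sigma]
  refine Finset.sum_congr rfl fun i _ => ?_
  by_cases h : i ∈ K
  · simp [maskL, h]
  · rw [if_neg h, EuclideanSpace.norm_sq_eq]
    refine Finset.sum_congr rfl fun a _ => ?_
    rw [maskL_apply_of_notMem x (c := ⟨i, a⟩) h]
    rfl

lemma norm_maskL_le (K : Set (Fin r)) (x : BlockVec d) : ‖maskL d K x‖ ≤ ‖x‖ := by
  refine le_of_sq_le_sq ?_ (norm_nonneg _)
  rw [EuclideanSpace.norm_sq_eq, EuclideanSpace.norm_sq_eq]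
  refine Finset.sum_le_sum fun c _ => ?_
  by_cases h : c.1 ∈ K
  · simp only [maskL, LinearMap.coe_mk, AddHom.coe_mk, h, if_true, norm_zero]
    rw [zero_pow two_ne_zero]
    exact sq_nonneg _
  · rw [maskL_apply_of_notMem x h]

/-- The full column rank of `[E_I F_J]` in terms of the projections onto the remaining blocks. -/
lemma eq_zero_of_fullColumnRank {k l p : ℕ} {m : Fin k → ℕ} {n : Fin l → ℕ}
    {E : BlockMatrix p m} {F : BlockMatrix p n} {I : Set (Fin k)} {J : Set (Fin l)}
    (hrank : FullColumnRank (Matrix.fromCols (colBlocks E I) (colBlocks F J)))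
    (x : BlockVec m) (z : BlockVec n) (hx : maskL m I x = 0) (hz : maskL n J z = 0)
    (hEF : Matrix.toEuclideanLin E x + Matrix.toEuclideanLin F z = 0) : x = 0 ∧ z = 0 := by
  classical
  have hx' : ∀ c : BlockIndex m, c.1 ∉ I → x c = 0 := fun c hc => by
    rw [← maskL_apply_of_notMem x hc, hx]; rfl
  have hz' : ∀ c : BlockIndex n, c.1 ∉ J → z c = 0 := fun c hc => by
    rw [← maskL_apply_of_notMem z hc, hz]; rfl
  have hinj := Matrix.mulVec_injective_iff.mpr hrank
  have hsum : ∀ {r : ℕ} {d : Fin r → ℕ} (A : BlockMatrix p d) (K : Set (Fin r)) (v : BlockVec d),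
      (∀ c : BlockIndex d, c.1 ∉ K → v c = 0) →
      (colBlocks A K).mulVec (fun c => v c.1) = A.mulVec v := by
    intro r d A K v hv
    ext i
    have h1 := Finset.sum_subtype (p := fun c : BlockIndex d => c.1 ∈ K) (F := inferInstance)
      (Finset.univ.filter fun c : BlockIndex d => c.1 ∈ K) (by simp) (fun c => A i c * v c)
    have h2 : ∑ c with c.1 ∈ K, A i c * v c = ∑ c, A i c * v c := by
      refine Finset.sum_subset (Finset.filter_subset _ _) fun c _ hc => ?_
      rw [hv c (by simpa using hc), mul_zero]
    exact h1.symm.trans h2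
  have hzero : Sum.elim (fun c : {c : BlockIndex m // c.1 ∈ I} => x c.1)
      (fun c : {c : BlockIndex n // c.1 ∈ J} => z c.1) = 0 := by
    refine hinj ?_
    rw [Matrix.mulVec_zero, Matrix.fromCols_mulVec]
    change (colBlocks E I).mulVec (fun c => x c.1) + (colBlocks F J).mulVec (fun c => z c.1) = 0
    rw [hsum E I x hx', hsum F J z hz']
    exact congrArg WithLp.ofLp hEF
  constructor
  · ext c
    by_cases h : c.1 ∈ I
    · exact congrFun hzero (Sum.inl ⟨c, h⟩)
    · exact hx' c h
  · ext c
    by_cases h : c.1 ∈ J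
    · exact congrFun hzero (Sum.inr ⟨c, h⟩)
    · exact hz' c h

lemma range_toEuclideanLin_le {p : ℕ} {ι κ : Type} [Fintype ι] [Fintype κ] [DecidableEq ι]
    [DecidableEq κ] {E : Matrix (Fin p) ι ℝ} {F : Matrix (Fin p) κ ℝ}
    (h : LinearMap.range F.mulVecLin ≤ LinearMap.range E.mulVecLin) :
    LinearMap.range (Matrix.toEuclideanLin F) ≤ LinearMap.range (Matrix.toEuclideanLin E) := by
  rintro _ ⟨z, rfl⟩
  obtain ⟨x, hx⟩ := h ⟨z, rfl⟩
  exact ⟨WithLp.toLp 2 x, congrArg (WithLp.toLp 2) hx⟩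

end Blocks

section Sums

lemma sum_coe_toReal {ι : Type} (s : Finset ι) (a : ι → EReal) (hbot : ∀ i, a i ≠ ⊥)
    (htop : ∀ i ∈ s, a i < ⊤) : ∑ i ∈ s, a i = ((∑ i ∈ s, (a i).toReal : ℝ) : EReal) := by
  classical
  induction s using Finset.induction_on with
  | empty => simp
  | insert i s hi ih =>
    rw [Finset.sum_insert hi, Finset.sum_insert hi, EReal.coe_add,
      ih fun j hj => htop j (Finset.mem_insert_of_mem hj),
      EReal.coe_toReal (htop i (Finset.mem_insert_self _ _)).ne (hbot i)]

lemma sum_ne_bot {ι : Type} (s : Finset ι) (a : ι → EReal) (hbot : ∀ i, a i ≠ ⊥) :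
    ∑ i ∈ s, a i ≠ ⊥ := by
  classical
  induction s using Finset.induction_on with
  | empty => simp
  | insert i s hi ih =>
    rw [Finset.sum_insert hi, ne_eq, EReal.add_eq_bot_iff]
    simp [hbot i, ih]

lemma lt_top_of_sum_lt_top {ι : Type} (s : Finset ι) (a : ι → EReal) (hbot : ∀ i, a i ≠ ⊥)
    (h : ∑ i ∈ s, a i < ⊤) : ∀ i ∈ s, a i < ⊤ := by
  classical
  intro i hi
  rw [← Finset.add_sum_erase s a hi] at h
  exact lt_top_iff_ne_top.mpr
    ((EReal.add_ne_top_iff_ne_top₂ (hbot i) (sum_ne_bot _ _ hbot)).mp h.ne).1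

lemma lowerSemicontinuous_sum_of_ne_bot {V ι : Type} [TopologicalSpace V] (s : Finset ι)
    (a : ι → V → EReal) (hbot : ∀ i v, a i v ≠ ⊥) (h : ∀ i, LowerSemicontinuous (a i)) :
    LowerSemicontinuous fun v => ∑ i ∈ s, a i v := by
  classical
  induction s using Finset.induction_on with
  | empty => simpa using lowerSemicontinuous_const
  | insert i s hi ih =>
    simp only [Finset.sum_insert hi]
    exact (h i).add' ih fun v => EReal.continuousAt_add (Or.inr (sum_ne_bot _ _ fun j => hbot j v))
      (Or.inl (hbot i v))

variable {l : ℕ} {n : Fin l → ℕ} {g : ∀ j, EuclideanSpace ℝ (Fin (n j)) → EReal}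

lemma mem_effDom_nonsmoothPart (hbot : ∀ j v, g j v ≠ ⊥) {z : BlockVec n} :
    z ∈ effDom (nonsmoothPart g) ↔ ∀ j, block z j ∈ effDom (g j) := by
  constructor
  · intro h j
    exact lt_top_of_sum_lt_top _ _ (fun j => hbot j _) h j (Finset.mem_univ j)
  · intro h
    change ∑ j, g j (block z j) < ⊤
    rw [sum_coe_toReal _ _ (fun j => hbot j _) fun j _ => h j]
    exact EReal.coe_lt_top _

lemma nonsmoothPart_eq_coe (hbot : ∀ j v, g j v ≠ ⊥) {z : BlockVec n}
    (hz : z ∈ effDom (nonsmoothPart g)) :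
    nonsmoothPart g z = ((∑ j, (g j (block z j)).toReal : ℝ) : EReal) :=
  sum_coe_toReal _ _ (fun j => hbot j _) fun j _ => (mem_effDom_nonsmoothPart hbot).mp hz j

lemma IsProperClosedConvex.combo_le {V : Type} [NormedAddCommGroup V] [InnerProductSpace ℝ V]
    {g : V → EReal} (h : IsProperClosedConvex g) {u v : V} (hu : u ∈ effDom g)
    (hv : v ∈ effDom g) {a b : ℝ} (ha : 0 ≤ a) (hb : 0 ≤ b) (hab : a + b = 1) :
    g (a • u + b • v) ≤ ((a * (g u).toReal + b * (g v).toReal : ℝ) : EReal) := by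
  have hu' : ((u, (g u).toReal) : V × ℝ) ∈ {w : V × ℝ | g w.1 ≤ (w.2 : EReal)} :=
    (coe_toReal_of_mem_effDom h.ne_bot hu).ge
  have hv' : ((v, (g v).toReal) : V × ℝ) ∈ {w : V × ℝ | g w.1 ≤ (w.2 : EReal)} :=
    (coe_toReal_of_mem_effDom h.ne_bot hv).ge
  exact h.convex_epigraph hu' hv' ha hb hab

/-- The sum of the `g_j` is proper, closed and convex, and strongly convex in the blocks outside
`J`. -/
lemma closedStrongConvexAlong_nonsmoothPart {J : Set (Fin l)} {c : ℝ}
    (hg : ∀ j, IsProperClosedConvex (g j)) (hJ : ∀ j, j ∉ J → ExtStrongConvex c (g j)) :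
    ClosedStrongConvexAlong c (maskL n J) (nonsmoothPart g) := by
  classical
  have hbot : ∀ j v, g j v ≠ ⊥ := fun j => (hg j).ne_bot
  refine ⟨fun z => sum_ne_bot _ _ fun j => hbot j _, ?_, ?_, ?_⟩
  · choose v hv using fun j => (hg j).nonempty_effDom
    exact ⟨WithLp.toLp 2 fun c => v c.1 c.2, (mem_effDom_nonsmoothPart hbot).mpr hv⟩
  · refine lowerSemicontinuous_sum_of_ne_bot _ _ (fun j v => hbot j _) fun j => ?_
    exact LowerSemicontinuous.comp (hg j).lowerSemicontinuous
      (restrictL (fun a : Fin (n j) => (⟨j, a⟩ : BlockIndex n))).continuous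
  · intro u hu v hv a b ha hb hab
    have hu' := (mem_effDom_nonsmoothPart hbot).mp hu
    have hv' := (mem_effDom_nonsmoothPart hbot).mp hv
    have hle : ∀ j, g j (block (a • u + b • v) j) ≤ ((a * (g j (block u j)).toReal
        + b * (g j (block v j)).toReal
        - c / 2 * (a * b) * (if j ∈ J then 0 else ‖block (u - v) j‖ ^ 2) : ℝ) : EReal) := by
      intro j
      rw [block_combo]
      by_cases h : j ∈ J
      · rw [if_pos h, mul_zero, sub_zero]
        exact (hg j).combo_le (hu' j) (hv' j) ha hb hab
      · rw [if_neg h, block_sub]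
        exact hJ j h (hu' j) (hv' j) ha hb hab
    have hw : a • u + b • v ∈ effDom (nonsmoothPart g) :=
      (mem_effDom_nonsmoothPart hbot).mpr fun j =>
        lt_of_le_of_lt (hle j) (EReal.coe_lt_top _)
    rw [nonsmoothPart_eq_coe hbot hw, nonsmoothPart_eq_coe hbot hu, nonsmoothPart_eq_coe hbot hv,
      EReal.toReal_coe, EReal.toReal_coe, EReal.coe_le_coe_iff, norm_maskL_sq, Finset.mul_sum,
      Finset.mul_sum, Finset.mul_sum, ← Finset.sum_add_distrib, ← Finset.sum_sub_distrib]
    refine Finset.sum_le_sum fun j _ => ?_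
    have h1 := hle j
    rwa [← coe_toReal_of_mem_effDom (hbot j) ((mem_effDom_nonsmoothPart hbot).mp hw j),
      EReal.coe_le_coe_iff] at h1

variable {k : ℕ} {m : Fin k → ℕ} {f : ∀ i, EuclideanSpace ℝ (Fin (m i)) → ℝ}

lemma strongConvexAlong_smoothPart {I : Set (Fin k)} {c : ℝ}
    (hf : ∀ i, ConvexOn ℝ Set.univ (f i)) (hI : ∀ i, i ∉ I → StrongConvexOn Set.univ c (f i)) :
    StrongConvexAlong c (maskL m I) (smoothPart f) := by
  classical
  intro u v a b ha hb hab
  simp only [smoothPart]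
  rw [norm_maskL_sq, Finset.mul_sum, Finset.mul_sum, Finset.mul_sum, ← Finset.sum_add_distrib,
    ← Finset.sum_sub_distrib]
  refine Finset.sum_le_sum fun i _ => ?_
  rw [block_combo]
  by_cases h : i ∈ I
  · rw [if_pos h, mul_zero, sub_zero]
    exact (hf i).2 trivial trivial ha hb hab
  · rw [if_neg h, block_sub]
    have h1 := (hI i h).2 (x := block u i) trivial (y := block v i) trivial ha hb hab
    simp only [smul_eq_mul] at h1
    linarith

lemma differentiable_smoothPart (hf : ∀ i, Differentiable ℝ (f i)) :
    Differentiable ℝ (smoothPart f) := by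
  unfold smoothPart
  refine Differentiable.fun_sum fun i _ => ?_
  exact (hf i).comp (restrictL fun a : Fin (m i) => (⟨i, a⟩ : BlockIndex m)).differentiable

end Sums

/-! ### The gradients of the proximal augmented Lagrangian -/

section Gradient

variable {V W : Type} [NormedAddCommGroup V] [InnerProductSpace ℝ V] [CompleteSpace V]
  [NormedAddCommGroup W] [InnerProductSpace ℝ W] [CompleteSpace W]

lemma hasGradientAt_add {f g : V → ℝ} {a b x : V} (hf : HasGradientAt f a x)
    (hg : HasGradientAt g b x) : HasGradientAt (fun u => f u + g u) (a + b) x := by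
  rw [hasGradientAt_iff_hasFDerivAt, map_add]
  exact hf.hasFDerivAt.add hg.hasFDerivAt

lemma hasGradientAt_add_const {f : V → ℝ} {a x : V} (hf : HasGradientAt f a x) (c : ℝ) :
    HasGradientAt (fun u => f u + c) a x :=
  hasGradientAt_iff_hasFDerivAt.mpr (hf.hasFDerivAt.add_const c)

lemma hasGradientAt_const_mul_norm_sq (c : ℝ) (x : V) :
    HasGradientAt (fun u => c * ‖u‖ ^ 2) ((2 * c) • x) x := by
  rw [hasGradientAt_iff_hasFDerivAt]
  refine (((hasFDerivAt_id (𝕜 := ℝ) x).norm_sq).const_mul c).congr_fderiv ?_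
  ext v
  simp
  ring

lemma hasGradientAt_comp_affine [FiniteDimensional ℝ V] [FiniteDimensional ℝ W] (A : V →ₗ[ℝ] W)
    (b : W) {h : W → ℝ} {d : W} {x : V} (hh : HasGradientAt h d (A x + b)) :
    HasGradientAt (fun u => h (A u + b)) (adjoint A d) x := by
  rw [hasGradientAt_iff_hasFDerivAt]
  have h1 : HasFDerivAt (fun u => A u + b) A.toContinuousLinearMap x :=
    A.toContinuousLinearMap.hasFDerivAt.add_const b
  refine (hh.hasFDerivAt.comp x h1).congr_fderiv ?_
  ext v
  simp [LinearMap.adjoint_inner_left]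

end Gradient

section Flow

variable {k l p : ℕ} {m : Fin k → ℕ} {n : Fin l → ℕ} {E : BlockMatrix p m} {F : BlockMatrix p n}
  {q : EuclideanSpace ℝ (Fin p)} {f : ∀ i, EuclideanSpace ℝ (Fin (m i)) → ℝ}
  {g : ∀ j, EuclideanSpace ℝ (Fin (n j)) → EReal} {μ α : ℝ}

/-- The vector field of the flow, in terms of the gradients of `f` and of the Moreau envelope. -/
lemma flowField_eq {f' : BlockVec m → BlockVec m} (hμ : 0 < μ)
    (hf : ∀ x, HasGradientAt (smoothPart f) (f' x) x)
    (hM : ∀ v, HasGradientAt (moreau μ (nonsmoothPart g)) (moreauGrad μ (nonsmoothPart g) v) v)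
    (ψ : State m n p) :
    flowField E F q f g μ α ψ = State.mk
      (-(f' ψ.x + adjoint (Matrix.toEuclideanLin E)
        ((1 / μ) • residual E F q ψ.x ψ.z + ψ.lam)))
      (-(moreauGrad μ (nonsmoothPart g) (ψ.z + μ • ψ.y) + adjoint (Matrix.toEuclideanLin F)
        ((1 / μ) • residual E F q ψ.x ψ.z + ψ.lam)))
      ((α * μ) • (moreauGrad μ (nonsmoothPart g) (ψ.z + μ • ψ.y) - ψ.y))
      (α • residual E F q ψ.x ψ.z) := by
  have hscale : ∀ w lam : EuclideanSpace ℝ (Fin p),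
      (2 * (1 / (2 * μ))) • (w + μ • lam) = (1 / μ) • w + lam := by
    intro w lam
    have : 2 * (1 / (2 * μ)) = 1 / μ := by field_simp
    rw [this, smul_add, smul_smul, one_div_mul_cancel hμ.ne', one_smul]
  have hx : HasGradientAt (fun x => proxAugLagrangian E F q f g μ x ψ.z ψ.y ψ.lam)
      (f' ψ.x + adjoint (Matrix.toEuclideanLin E)
        ((1 / μ) • residual E F q ψ.x ψ.z + ψ.lam)) ψ.x := by
    have h1 := hasGradientAt_comp_affine (Matrix.toEuclideanLin E)
      (Matrix.toEuclideanLin F ψ.z - q + μ • ψ.lam) (x := ψ.x)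
      (hasGradientAt_const_mul_norm_sq (1 / (2 * μ)) _)
    have e : ∀ x, Matrix.toEuclideanLin E x + (Matrix.toEuclideanLin F ψ.z - q + μ • ψ.lam) =
        residual E F q x ψ.z + μ • ψ.lam := fun x => by rw [residual]; abel
    simp only [e, hscale] at h1
    refine (hasGradientAt_add_const (hasGradientAt_add (hf ψ.x) h1)
      (moreau μ (nonsmoothPart g) (ψ.z + μ • ψ.y) - μ / 2 * ‖ψ.y‖ ^ 2
        - μ / 2 * ‖ψ.lam‖ ^ 2)).congr_of_eventuallyEq (Filter.Eventually.of_forall fun x => ?_)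
    simp only [proxAugLagrangian]
    ring
  have hz : HasGradientAt (fun z => proxAugLagrangian E F q f g μ ψ.x z ψ.y ψ.lam)
      (moreauGrad μ (nonsmoothPart g) (ψ.z + μ • ψ.y) + adjoint (Matrix.toEuclideanLin F)
        ((1 / μ) • residual E F q ψ.x ψ.z + ψ.lam)) ψ.z := by
    have h1 := hasGradientAt_comp_affine (Matrix.toEuclideanLin F)
      (Matrix.toEuclideanLin E ψ.x - q + μ • ψ.lam) (x := ψ.z)
      (hasGradientAt_const_mul_norm_sq (1 / (2 * μ)) _)
    have e : ∀ z, Matrix.toEuclideanLin F z + (Matrix.toEuclideanLin E ψ.x - q + μ • ψ.lam) =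
        residual E F q ψ.x z + μ • ψ.lam := fun z => by rw [residual]; abel
    simp only [e, hscale] at h1
    have h2 := hasGradientAt_comp_affine (LinearMap.id : BlockVec n →ₗ[ℝ] BlockVec n) (μ • ψ.y)
      (hM (LinearMap.id ψ.z + μ • ψ.y))
    rw [LinearMap.adjoint_id] at h2
    refine (hasGradientAt_add_const (hasGradientAt_add h2 h1)
      (smoothPart f ψ.x - μ / 2 * ‖ψ.y‖ ^ 2
        - μ / 2 * ‖ψ.lam‖ ^ 2)).congr_of_eventuallyEq (Filter.Eventually.of_forall fun z => ?_)
    simp only [proxAugLagrangian, LinearMap.id_apply]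
    ring
  have hy : HasGradientAt (fun y => proxAugLagrangian E F q f g μ ψ.x ψ.z y ψ.lam)
      (μ • (moreauGrad μ (nonsmoothPart g) (ψ.z + μ • ψ.y) - ψ.y)) ψ.y := by
    have h2 := hasGradientAt_comp_affine (μ • (LinearMap.id : BlockVec n →ₗ[ℝ] BlockVec n)) ψ.z
      (hM ((μ • (LinearMap.id : BlockVec n →ₗ[ℝ] BlockVec n)) ψ.y + ψ.z))
    have e : ∀ y, (μ • (LinearMap.id : BlockVec n →ₗ[ℝ] BlockVec n)) y + ψ.z = ψ.z + μ • y :=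
      fun y => add_comm _ _
    have e2 : ∀ w, adjoint (μ • (LinearMap.id : BlockVec n →ₗ[ℝ] BlockVec n)) w = μ • w := by
      intro w
      refine ext_inner_right ℝ fun v => ?_
      rw [LinearMap.adjoint_inner_left, LinearMap.smul_apply, LinearMap.id_apply,
        real_inner_smul_left, real_inner_smul_right]
    simp only [e, e2] at h2
    have h3 := hasGradientAt_add_const
      (hasGradientAt_add h2 (hasGradientAt_const_mul_norm_sq (-(μ / 2)) ψ.y))
      (smoothPart f ψ.x + 1 / (2 * μ) * ‖residual E F q ψ.x ψ.z + μ • ψ.lam‖ ^ 2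
        - μ / 2 * ‖ψ.lam‖ ^ 2)
    have e3 : μ • moreauGrad μ (nonsmoothPart g) (ψ.z + μ • ψ.y) + (2 * -(μ / 2)) • ψ.y =
        μ • (moreauGrad μ (nonsmoothPart g) (ψ.z + μ • ψ.y) - ψ.y) := by
      rw [smul_sub, sub_eq_add_neg, ← neg_smul]; congr 2; ring
    rw [e3] at h3
    refine h3.congr_of_eventuallyEq (Filter.Eventually.of_forall fun y => ?_)
    simp only [proxAugLagrangian]
    ring
  have hlam : HasGradientAt (fun lam => proxAugLagrangian E F q f g μ ψ.x ψ.z ψ.y lam)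
      (residual E F q ψ.x ψ.z) ψ.lam := by
    -- after expanding the square, the quadratic terms in `λ` cancel
    have h1 : HasGradientAt (InnerProductSpace.toDual ℝ (EuclideanSpace ℝ (Fin p))
        (residual E F q ψ.x ψ.z)) (residual E F q ψ.x ψ.z) ψ.lam :=
      hasGradientAt_iff_hasFDerivAt.mpr (ContinuousLinearMap.hasFDerivAt _)
    refine (hasGradientAt_add_const h1
      (smoothPart f ψ.x + moreau μ (nonsmoothPart g) (ψ.z + μ • ψ.y)
        + 1 / (2 * μ) * ‖residual E F q ψ.x ψ.z‖ ^ 2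
        - μ / 2 * ‖ψ.y‖ ^ 2)).congr_of_eventuallyEq (Filter.Eventually.of_forall fun lam => ?_)
    simp only [proxAugLagrangian, InnerProductSpace.toDual_apply_apply]
    rw [norm_add_sq_real, real_inner_smul_right, norm_smul, Real.norm_of_nonneg hμ.le]
    field_simp
    ring
  rw [flowField, hx.gradient, hz.gradient, hy.gradient, hlam.gradient, smul_smul]

/-! ### Strong convexity in the primal variables -/

/-- The strong convexity modulus combines those of `f`, of the Moreau envelope and of the
augmentation term, which together control all the directions. -/
lemma exists_primalStrongConvex {S : BlockVec m →ₗ[ℝ] BlockVec m}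
    {T : BlockVec n →ₗ[ℝ] BlockVec n} {cf cg : ℝ} (hT : ∀ v, ‖T v‖ ≤ ‖v‖)
    (hinj : ∀ x z, S x = 0 → T z = 0 →
      Matrix.toEuclideanLin E x + Matrix.toEuclideanLin F z = 0 → x = 0 ∧ z = 0)
    (hμ : 0 < μ) (hcf : 0 < cf) (hcg : 0 < cg) :
    ∃ c : ℝ, 0 < c ∧ ∀ (q : EuclideanSpace ℝ (Fin p))
      (f : ∀ i, EuclideanSpace ℝ (Fin (m i)) → ℝ)
      (g : ∀ j, EuclideanSpace ℝ (Fin (n j)) → EReal),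
      StrongConvexAlong cf S (smoothPart f) → ClosedStrongConvexAlong cg T (nonsmoothPart g) →
      PrimalStrongConvex E F q f g μ c := by
  obtain ⟨κ, hκ, hκle⟩ := exists_mul_add_sq_norm_le S T _ _ hinj
  set cM := cg / (1 + μ * cg)
  have hcM : 0 < cM := by positivity
  set c := min (min cf cM) (1 / μ)
  have hc : 0 < c := by positivity
  have hc1 : c ≤ cf := (min_le_left _ _).trans (min_le_left _ _)
  have hc2 : c ≤ cM := (min_le_left _ _).trans (min_le_right _ _)
  have hc3 : c ≤ 1 / μ := min_le_right _ _
  refine ⟨c * κ, by positivity, fun q f g hf hg y lam => ⟨convex_univ, ?_⟩⟩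
  intro u _ v _ a b ha hb hab
  set ux : BlockVec m := restrictL Sum.inl u
  set uz : BlockVec n := restrictL Sum.inr u
  set vx : BlockVec m := restrictL Sum.inl v
  set vz : BlockVec n := restrictL Sum.inr v
  have h1 := hf ux vx a b ha hb hab
  have h2 := hg.moreau_combo_le hcg.le hμ hT (uz + μ • y) (vz + μ • y) ha hb hab
  have e2 : a • (uz + μ • y) + b • (vz + μ • y) = (a • uz + b • vz) + μ • y := by
    obtain rfl : b = 1 - a := by linarith
    module
  rw [e2, add_sub_add_right_eq_sub] at h2
  have e3 : residual E F q (a • ux + b • vx) (a • uz + b • vz) + μ • lam =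
      a • (residual E F q ux uz + μ • lam) + b • (residual E F q vx vz + μ • lam) := by
    simp only [residual, map_add, map_smul]
    obtain rfl : b = 1 - a := by linarith
    module
  have e4 : residual E F q ux uz + μ • lam - (residual E F q vx vz + μ • lam) =
      Matrix.toEuclideanLin E (ux - vx) + Matrix.toEuclideanLin F (uz - vz) := by
    simp only [residual, map_sub]
    abel
  have h3 := norm_combo_sq hab (residual E F q ux uz + μ • lam) (residual E F q vx vz + μ • lam)
  rw [← e3, e4] at h3
  have h4 := hκle (ux - vx) (uz - vz)
  have e5 : ‖u - v‖ ^ 2 = ‖ux - vx‖ ^ 2 + ‖uz - vz‖ ^ 2 := by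
    rw [norm_sq_sum_eq, map_sub, map_sub]
  set d := ‖Matrix.toEuclideanLin E (ux - vx) + Matrix.toEuclideanLin F (uz - vz)‖ ^ 2
  have h5 : c * κ * ‖u - v‖ ^ 2 ≤ cf * ‖S (ux - vx)‖ ^ 2 + cM * ‖T (uz - vz)‖ ^ 2
      + 1 / μ * d := by
    rw [e5]
    calc c * κ * (‖ux - vx‖ ^ 2 + ‖uz - vz‖ ^ 2)
        = c * (κ * (‖ux - vx‖ ^ 2 + ‖uz - vz‖ ^ 2)) := by ring
      _ ≤ c * (‖S (ux - vx)‖ ^ 2 + ‖T (uz - vz)‖ ^ 2 + d) := by gcongr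
      _ = c * ‖S (ux - vx)‖ ^ 2 + c * ‖T (uz - vz)‖ ^ 2 + c * d := by ring
      _ ≤ _ := by gcongr
  have h6 := mul_le_mul_of_nonneg_left h5 (mul_nonneg ha hb)
  change proxAugLagrangian E F q f g μ (a • ux + b • vx) (a • uz + b • vz) y lam ≤
    a • proxAugLagrangian E F q f g μ ux uz y lam + b • proxAugLagrangian E F q f g μ vx vz y lam
      - a * b * (c * κ / 2 * ‖u - v‖ ^ 2)
  simp only [proxAugLagrangian, smul_eq_mul]
  rw [h3]
  have e6 : 1 / μ = 2 * (1 / (2 * μ)) := by field_simp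
  rw [e6] at h6
  have e7 : μ / 2 * ‖y‖ ^ 2 = a * (μ / 2 * ‖y‖ ^ 2) + b * (μ / 2 * ‖y‖ ^ 2) := by
    rw [← add_mul, hab, one_mul]
  have e8 : μ / 2 * ‖lam‖ ^ 2 = a * (μ / 2 * ‖lam‖ ^ 2) + b * (μ / 2 * ‖lam‖ ^ 2) := by
    rw [← add_mul, hab, one_mul]
  linarith

end Flow

/-! ### Trajectories of the flow -/

namespace State

variable {k l p : ℕ} {m : Fin k → ℕ} {n : Fin l → ℕ}

/-- The component `x` of a state, as a continuous linear map. -/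
noncomputable def xL : State m n p →L[ℝ] BlockVec m := restrictL (Sum.inl ∘ Sum.inl)

/-- The component `z` of a state, as a continuous linear map. -/
noncomputable def zL : State m n p →L[ℝ] BlockVec n := restrictL (Sum.inl ∘ Sum.inr)

/-- The component `y` of a state, as a continuous linear map. -/
noncomputable def yL : State m n p →L[ℝ] BlockVec n := restrictL (Sum.inr ∘ Sum.inl)

/-- The component `λ` of a state, as a continuous linear map. -/
noncomputable def lamL : State m n p →L[ℝ] EuclideanSpace ℝ (Fin p) :=
  restrictL (Sum.inr ∘ Sum.inr)

lemma norm_sq_eq (ψ : State m n p) :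
    ‖ψ‖ ^ 2 = ‖ψ.x‖ ^ 2 + ‖ψ.z‖ ^ 2 + ‖ψ.y‖ ^ 2 + ‖ψ.lam‖ ^ 2 := by
  rw [norm_sq_sum_eq, norm_sq_sum_eq, norm_sq_sum_eq, ← add_assoc]
  rfl

lemma eq_zero_iff {ψ : State m n p} :
    ψ = 0 ↔ ψ.x = 0 ∧ ψ.z = 0 ∧ ψ.y = 0 ∧ ψ.lam = 0 := by
  constructor
  · rintro rfl
    exact ⟨rfl, rfl, rfl, rfl⟩
  · rintro ⟨hx, hz, hy, hlam⟩
    have h := norm_sq_eq ψ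
    rw [hx, hz, hy, hlam] at h
    simpa using h

end State

section Flow

variable {k l p : ℕ} {m : Fin k → ℕ} {n : Fin l → ℕ} {E : BlockMatrix p m} {F : BlockMatrix p n}
  {q : EuclideanSpace ℝ (Fin p)} {f : ∀ i, EuclideanSpace ℝ (Fin (m i)) → ℝ}
  {g : ∀ j, EuclideanSpace ℝ (Fin (n j)) → EReal} {μ α : ℝ} {f' : BlockVec m → BlockVec m}

/-- The equilibria of the flow are the Karush-Kuhn-Tucker points. -/
lemma mem_equilibria_iff (hμ : 0 < μ) (hα : 0 < α)
    (hf : ∀ x, HasGradientAt (smoothPart f) (f' x) x)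
    (hM : ∀ v, HasGradientAt (moreau μ (nonsmoothPart g)) (moreauGrad μ (nonsmoothPart g) v) v)
    (ψ : State m n p) :
    ψ ∈ equilibria E F q f g μ α ↔
      IsKKT (Matrix.toEuclideanLin E) (Matrix.toEuclideanLin F) q f' μ (nonsmoothPart g)
        ψ.x ψ.z ψ.y ψ.lam := by
  change flowField E F q f g μ α ψ = 0 ↔ _
  rw [flowField_eq hμ hf hM, State.eq_zero_iff]
  change -(f' ψ.x + adjoint (Matrix.toEuclideanLin E)
        ((1 / μ) • residual E F q ψ.x ψ.z + ψ.lam)) = 0 ∧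
      -(moreauGrad μ (nonsmoothPart g) (ψ.z + μ • ψ.y) + adjoint (Matrix.toEuclideanLin F)
        ((1 / μ) • residual E F q ψ.x ψ.z + ψ.lam)) = 0 ∧
      (α * μ) • (moreauGrad μ (nonsmoothPart g) (ψ.z + μ • ψ.y) - ψ.y) = 0 ∧
      α • residual E F q ψ.x ψ.z = 0 ↔ _
  rw [neg_eq_zero, neg_eq_zero, smul_eq_zero_iff_right (by positivity),
    smul_eq_zero_iff_right hα.ne', sub_eq_zero]
  constructor
  · rintro ⟨h1, h2, h3, h4⟩
    rw [h4, smul_zero, zero_add] at h1 h2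
    rw [h3] at h2
    exact ⟨h1, h2, h3, sub_eq_zero.mp h4⟩
  · rintro ⟨h1, h2, h3, h4⟩
    have h4' : residual E F q ψ.x ψ.z = 0 := sub_eq_zero.mpr h4
    rw [h4', h3, smul_zero, zero_add]
    exact ⟨h1, h2, rfl, rfl⟩

lemma exists_affineSubspace_eq {E : BlockMatrix p m} {x₀ : BlockVec m} {z₀ y₀ : BlockVec n}
    {lam₀ : EuclideanSpace ℝ (Fin p)} {s : Set (State m n p)}
    (hs : ∀ ψ : State m n p, ψ ∈ s ↔ ψ.x = x₀ ∧ ψ.z = z₀ ∧ ψ.y = y₀ ∧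
      adjoint (Matrix.toEuclideanLin E) (ψ.lam - lam₀) = 0) :
    ∃ A : AffineSubspace ℝ (State m n p), (A : Set (State m n p)).Nonempty ∧
      (A : Set (State m n p)) = s := by
  refine ⟨AffineSubspace.mk' (State.mk x₀ z₀ y₀ lam₀)
    ((State.xL (m := m) (n := n) (p := p)).toLinearMap.ker
      ⊓ (State.zL (m := m) (n := n) (p := p)).toLinearMap.ker
      ⊓ (State.yL (m := m) (n := n) (p := p)).toLinearMap.ker
      ⊓ (adjoint (Matrix.toEuclideanLin E)
        ∘ₗ (State.lamL (m := m) (n := n) (p := p)).toLinearMap).ker),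
    ⟨_, AffineSubspace.self_mem_mk' _ _⟩, ?_⟩
  ext ψ
  rw [hs, SetLike.mem_coe, AffineSubspace.mem_mk', vsub_eq_sub]
  simp only [Submodule.mem_inf, LinearMap.mem_ker, ContinuousLinearMap.coe_coe, map_sub,
    LinearMap.comp_apply, and_assoc]
  exact and_congr sub_eq_zero (and_congr sub_eq_zero (and_congr sub_eq_zero Iff.rfl))

/-- The component of `λ` in the kernel of the adjoint of `E` is constant along the flow. -/
lemma inner_eq_zero_of_hasDerivWithinAt {X Z P : Type} [NormedAddCommGroup X]
    [InnerProductSpace ℝ X] [FiniteDimensional ℝ X] [NormedAddCommGroup Z] [InnerProductSpace ℝ Z]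
    [FiniteDimensional ℝ Z] [NormedAddCommGroup P] [InnerProductSpace ℝ P] [FiniteDimensional ℝ P]
    {E : X →ₗ[ℝ] P} {F : Z →ₗ[ℝ] P} (hrange : LinearMap.range F ≤ LinearMap.range E) {α t₀ : ℝ}
    {x : ℝ → X} {z : ℝ → Z} {lam : ℝ → P}
    (hlam : ∀ t, t₀ ≤ t → HasDerivWithinAt lam (α • (E (x t) + F (z t))) (Set.Ici t₀) t)
    (h₀ : ∀ w, adjoint E w = 0 → ⟪w, lam t₀⟫_ℝ = 0) {t : ℝ} (ht : t₀ ≤ t) {w : P}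
    (hw : adjoint E w = 0) : ⟪w, lam t⟫_ℝ = 0 := by
  have key : ∀ w, adjoint E w = 0 → ⟪w, lam t⟫_ℝ ≤ 0 := by
    intro w hw
    have hder : ∀ s, t₀ ≤ s → HasDerivWithinAt (fun s => ⟪w, lam s⟫_ℝ) 0 (Set.Ici t₀) s := by
      intro s hs
      refine ((hasDerivWithinAt_const s _ w).inner ℝ (hlam s hs)).congr_deriv ?_
      rw [inner_zero_left, add_zero, real_inner_smul_right, inner_add_right,
        ← LinearMap.adjoint_inner_left, ← LinearMap.adjoint_inner_left, hw,
        adjoint_eq_zero_of_range_le hrange hw, inner_zero_left, inner_zero_left, add_zero, mul_zero]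
    have h := le_mul_exp_of_hasDerivWithinAt_le (ρ := 0) hder (fun s _ => by simp) ht
    rwa [h₀ w hw, zero_mul] at h
  refine le_antisymm (key w hw) ?_
  have h := key (-w) (by rw [map_neg, hw, neg_zero])
  rw [inner_neg_left] at h
  linarith

/-- A solution converges exponentially to the projection of its initial value onto the set of
equilibria. This point has the same component of `λ` in the kernel of the adjoint of `E` as the
initial value, so that the deviation from it satisfies the error system. -/
lemma exists_limit_of_isSolution {M ρ L κ cf cg t₀ : ℝ} {S : BlockVec m →ₗ[ℝ] BlockVec m}
    {T : BlockVec n →ₗ[ℝ] BlockVec n} (hμ : 0 < μ) (hα : 0 < α) (hρ : 0 < ρ) (hcg : 0 ≤ cg)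
    (hbound : IsExponentialBound (Matrix.toEuclideanLin E) (Matrix.toEuclideanLin F) μ α L κ M ρ)
    (hκ : IsDissipationBound S T (Matrix.toEuclideanLin E) (Matrix.toEuclideanLin F) μ cf cg κ)
    (hrange : LinearMap.range (Matrix.toEuclideanLin F) ≤
      LinearMap.range (Matrix.toEuclideanLin E))
    (hf : ∀ x, HasGradientAt (smoothPart f) (f' x) x)
    (hfc : StrongConvexAlong cf S (smoothPart f))
    (hg : ClosedStrongConvexAlong cg T (nonsmoothPart g))
    (hL : ∀ x u, ‖f' x - f' u‖ ≤ L * ‖x - u‖)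
    {x₀ : BlockVec m} {z₀ y₀ : BlockVec n} {lam₀ : EuclideanSpace ℝ (Fin p)}
    (heq : ∀ ψ : State m n p, ψ ∈ equilibria E F q f g μ α ↔ ψ.x = x₀ ∧ ψ.z = z₀ ∧ ψ.y = y₀ ∧
      adjoint (Matrix.toEuclideanLin E) (ψ.lam - lam₀) = 0)
    {ψ : ℝ → State m n p} (hψ : IsSolution E F q f g μ α t₀ ψ) :
    ∃ ψs ∈ equilibria E F q f g μ α,
      (∀ φ ∈ equilibria E F q f g μ α, ‖ψ t₀ - ψs‖ ≤ ‖ψ t₀ - φ‖) ∧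
      Filter.Tendsto ψ Filter.atTop (nhds ψs) ∧
      ∀ t, t₀ ≤ t → ‖ψ t - ψs‖ ^ 2 ≤ M * ‖ψ t₀ - ψs‖ ^ 2 * Real.exp (-ρ * (t - t₀)) := by
  have hM := hg.hasGradientAt_moreau hcg hμ
  set E' := Matrix.toEuclideanLin E
  set F' := Matrix.toEuclideanLin F
  set G := moreauGrad μ (nonsmoothPart g)
  obtain ⟨w, hw, v, hv, hwv⟩ := (adjoint E').ker.exists_add_mem_mem_orthogonal
    ((ψ t₀).lam - lam₀)
  have hw' : adjoint E' w = 0 := hw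
  set ψs : State m n p := State.mk x₀ z₀ y₀ (lam₀ + w)
  have hψs : ψs ∈ equilibria E F q f g μ α := by
    refine (heq ψs).mpr ⟨rfl, rfl, rfl, ?_⟩
    change adjoint E' (lam₀ + w - lam₀) = 0
    rw [add_sub_cancel_left, hw']
  have hK := (mem_equilibria_iff hμ hα hf hM ψs).mp hψs
  have hKx : f' x₀ = -adjoint E' (lam₀ + w) := eq_neg_of_add_eq_zero_left hK.stationary_x
  have hKz : y₀ = -adjoint F' (lam₀ + w) := eq_neg_of_add_eq_zero_left hK.stationary_z
  have hKm : G (z₀ + μ • y₀) = y₀ := hK.moreauGrad_eq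
  have hKq : E' x₀ + F' z₀ = q := hK.feasible
  have hlam₀ : (ψ t₀).lam - (lam₀ + w) = v := by
    rw [← sub_sub, hwv, add_sub_cancel_left]
  have hres : ∀ t, residual E F q (ψ t).x (ψ t).z =
      E' ((ψ t).x - x₀) + F' ((ψ t).z - z₀) := by
    intro t
    rw [residual, ← hKq, map_sub, map_sub]
    abel
  have hder : ∀ t, t₀ ≤ t → HasDerivWithinAt ψ (flowField E F q f g μ α (ψ t)) (Set.Ici t₀) t := hψ
  simp only [flowField_eq hμ hf hM] at hder
  have hdx : ∀ t, t₀ ≤ t → HasDerivWithinAt (fun t => (ψ t).x - x₀)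
      (-(f' (ψ t).x - f' x₀) - adjoint E' ((1 / μ) • (E' ((ψ t).x - x₀) + F' ((ψ t).z - z₀))
        + ((ψ t).lam - (lam₀ + w)))) (Set.Ici t₀) t := by
    intro t ht
    have h := ((State.xL.hasFDerivAt (x := ψ t)).comp_hasDerivWithinAt t (hder t ht)).sub_const x₀
    refine h.congr_deriv ?_
    change -(f' (ψ t).x + adjoint E' ((1 / μ) • residual E F q (ψ t).x (ψ t).z + (ψ t).lam)) = _
    rw [hres, hKx, ← add_sub_assoc, map_sub (adjoint E') _ (lam₀ + w)]
    abel
  have hdz : ∀ t, t₀ ≤ t → HasDerivWithinAt (fun t => (ψ t).z - z₀)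
      (-(G ((ψ t).z + μ • (ψ t).y) - y₀)
        - adjoint F' ((1 / μ) • (E' ((ψ t).x - x₀) + F' ((ψ t).z - z₀))
        + ((ψ t).lam - (lam₀ + w)))) (Set.Ici t₀) t := by
    intro t ht
    have h := ((State.zL.hasFDerivAt (x := ψ t)).comp_hasDerivWithinAt t (hder t ht)).sub_const z₀
    refine h.congr_deriv ?_
    change -(G ((ψ t).z + μ • (ψ t).y)
      + adjoint F' ((1 / μ) • residual E F q (ψ t).x (ψ t).z + (ψ t).lam)) = _
    rw [hres, ← add_sub_assoc, map_sub (adjoint F') _ (lam₀ + w), hKz]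
    abel
  have hdy : ∀ t, t₀ ≤ t → HasDerivWithinAt (fun t => (ψ t).y - y₀)
      ((α * μ) • (G ((ψ t).z + μ • (ψ t).y) - y₀ - ((ψ t).y - y₀))) (Set.Ici t₀) t := by
    intro t ht
    have h := ((State.yL.hasFDerivAt (x := ψ t)).comp_hasDerivWithinAt t (hder t ht)).sub_const y₀
    refine h.congr_deriv ?_
    rw [sub_sub_sub_cancel_right]
    rfl
  have hdlam : ∀ t, t₀ ≤ t → HasDerivWithinAt (fun t => (ψ t).lam - (lam₀ + w))
      (α • (E' ((ψ t).x - x₀) + F' ((ψ t).z - z₀))) (Set.Ici t₀) t := by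
    intro t ht
    have h := ((State.lamL.hasFDerivAt (x := ψ t)).comp_hasDerivWithinAt t
      (hder t ht)).sub_const (lam₀ + w)
    refine h.congr_deriv ?_
    rw [← hres]
    rfl
  have horth : ∀ t, t₀ ≤ t → ∀ u, adjoint E' u = 0 → ⟪u, (ψ t).lam - (lam₀ + w)⟫_ℝ = 0 :=
    fun t ht u hu => inner_eq_zero_of_hasDerivWithinAt hrange hdlam (fun u hu => by
      simp only [hlam₀]
      exact hv u hu) ht hu
  have hexp : ∀ t, t₀ ≤ t →
      ‖ψ t - ψs‖ ^ 2 ≤ M * ‖ψ t₀ - ψs‖ ^ 2 * Real.exp (-ρ * (t - t₀)) := by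
    intro t ht
    rw [State.norm_sq_eq, State.norm_sq_eq]
    refine hbound t₀ _ _ _ _ _ _ hdx hdz hdy hdlam horth (fun t _ => hL _ _) (fun t _ => ?_) t ht
    have h := hg.le_inner_moreauGrad hcg hμ ((ψ t).z + μ • (ψ t).y) (z₀ + μ • y₀)
    have e : (ψ t).z + μ • (ψ t).y - (z₀ + μ • y₀) - μ • (G ((ψ t).z + μ • (ψ t).y) - y₀) =
        ((ψ t).z - z₀) + μ • (((ψ t).y - y₀) - (G ((ψ t).z + μ • (ψ t).y) - y₀)) := by
      simp only [smul_sub]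
      abel
    change cg * ‖T (_ - μ • (G _ - G _))‖ ^ 2 ≤ ⟪G _ - G _, _ - μ • (G _ - G _)⟫_ℝ at h
    rw [hKm, e] at h
    exact hκ _ _ _ _ _ (hfc.le_inner hf _ _) h
  refine ⟨ψs, hψs, fun φ hφ => ?_, ?_, hexp⟩
  · obtain ⟨hx, hz, hy, hlam⟩ := (heq φ).mp hφ
    refine le_of_sq_le_sq ?_ (norm_nonneg _)
    rw [State.norm_sq_eq, State.norm_sq_eq]
    change ‖(ψ t₀).x - x₀‖ ^ 2 + ‖(ψ t₀).z - z₀‖ ^ 2 + ‖(ψ t₀).y - y₀‖ ^ 2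
      + ‖(ψ t₀).lam - (lam₀ + w)‖ ^ 2 ≤ ‖(ψ t₀).x - φ.x‖ ^ 2 + ‖(ψ t₀).z - φ.z‖ ^ 2
      + ‖(ψ t₀).y - φ.y‖ ^ 2 + ‖(ψ t₀).lam - φ.lam‖ ^ 2
    rw [hx, hz, hy, hlam₀]
    have e : (ψ t₀).lam - φ.lam = (w - (φ.lam - lam₀)) + v := by
      rw [← hlam₀]; abel
    have h0 : ⟪w - (φ.lam - lam₀), v⟫_ℝ = 0 :=
      hv _ ((adjoint E').ker.sub_mem hw hlam)
    rw [e, norm_add_sq_real, h0]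
    have := sq_nonneg ‖w - (φ.lam - lam₀)‖
    linarith
  · rw [tendsto_iff_norm_sub_tendsto_zero]
    have h1 : Filter.Tendsto (fun t => M * ‖ψ t₀ - ψs‖ ^ 2 * Real.exp (-ρ * (t - t₀)))
        Filter.atTop (nhds 0) := by
      have h2 : Filter.Tendsto (fun t : ℝ => -ρ * (t - t₀)) Filter.atTop Filter.atBot :=
        (Filter.tendsto_atTop_add_const_right _ (-t₀) Filter.tendsto_id).const_mul_atTop_of_neg
          (neg_lt_zero.mpr hρ)
      have h3 := (Real.tendsto_exp_atBot.comp h2).const_mul (M * ‖ψ t₀ - ψs‖ ^ 2)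
      rwa [mul_zero] at h3
    have h2 : Filter.Tendsto (fun t => ‖ψ t - ψs‖ ^ 2) Filter.atTop (nhds 0) := by
      refine tendsto_of_tendsto_of_tendsto_of_le_of_le' tendsto_const_nhds h1
        (Filter.Eventually.of_forall fun t => sq_nonneg _) ?_
      filter_upwards [Filter.eventually_ge_atTop t₀] with t ht using hexp t ht
    have h3 := (Real.continuous_sqrt.tendsto 0).comp h2
    rw [Real.sqrt_zero] at h3
    refine h3.congr fun t => ?_
    exact Real.sqrt_sq (norm_nonneg _)

end Flow

end PDFlow

open PDFlow in
theorem theorem3 {k l p : ℕ} (m : Fin k → ℕ) (n : Fin l → ℕ)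
    (E : PDFlow.BlockMatrix p m) (F : PDFlow.BlockMatrix p n)
    (I : Set (Fin k)) (J : Set (Fin l)) (Lf : NNReal) (mf mg μ : ℝ)
    (hμ : 0 < μ) (hμmg : μ * mg ≤ 1)
    (hrank : PDFlow.FullColumnRank
      (Matrix.fromCols (PDFlow.colBlocks E I) (PDFlow.colBlocks F J)))
    (hrange : LinearMap.range F.mulVecLin ≤ LinearMap.range E.mulVecLin) :
    -- the proximal augmented Lagrangian has a strong convexity modulus in the primal variables
    (∃ mxz : ℝ, 0 < mxz ∧
      ∀ (q : EuclideanSpace ℝ (Fin p)) (f : ∀ i, EuclideanSpace ℝ (Fin (m i)) → ℝ)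
        (g : ∀ j, EuclideanSpace ℝ (Fin (n j)) → EReal),
        PDFlow.StandingAssumptions E F q f g Lf →
        PDFlow.StrongConvexityPattern f g I J mf mg →
        PDFlow.PrimalStrongConvex E F q f g μ mxz) ∧
    -- for every such modulus and every small `α`, the dynamics are globally exponentially stable
    (∀ mxz : ℝ, 0 < mxz → ∀ α : ℝ, 0 < α →
      α < mxz ^ 2 / (PDFlow.maxSingularValue (Matrix.fromCols E F) ^ 2 + 4) →
      ∃ M₂ ρ₂ : ℝ, 0 < M₂ ∧ 0 < ρ₂ ∧
        ∀ (q : EuclideanSpace ℝ (Fin p)) (f : ∀ i, EuclideanSpace ℝ (Fin (m i)) → ℝ)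
          (g : ∀ j, EuclideanSpace ℝ (Fin (n j)) → EReal),
          PDFlow.StandingAssumptions E F q f g Lf →
          PDFlow.StrongConvexityPattern f g I J mf mg →
          PDFlow.PrimalStrongConvex E F q f g μ mxz →
          (∃ A : AffineSubspace ℝ (PDFlow.State m n p), (A : Set (PDFlow.State m n p)).Nonempty ∧
            (A : Set (PDFlow.State m n p)) = PDFlow.equilibria E F q f g μ α) ∧
          ∀ (t₀ : ℝ) (ψ : ℝ → PDFlow.State m n p),
            PDFlow.IsSolution E F q f g μ α t₀ ψ →
            ∃ ψs ∈ PDFlow.equilibria E F q f g μ α,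
              (∀ φ ∈ PDFlow.equilibria E F q f g μ α, ‖ψ t₀ - ψs‖ ≤ ‖ψ t₀ - φ‖) ∧
              Filter.Tendsto ψ Filter.atTop (nhds ψs) ∧
              ∀ t, t₀ ≤ t →
                ‖ψ t - ψs‖ ^ 2 ≤ M₂ * ‖ψ t₀ - ψs‖ ^ 2 * Real.exp (-ρ₂ * (t - t₀))) := by
  have hT : ∀ v, ‖maskL n J v‖ ≤ ‖v‖ := norm_maskL_le J
  have hinj := eq_zero_of_fullColumnRank hrank
  have hrange' := range_toEuclideanLin_le hrange
  -- if there is no strongly convex block, the modulus may be nonpositive, and it plays no role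
  set cf := if 0 < mf then mf else 1
  set cg := if 0 < mg then mg else 1
  have hcf : 0 < cf := by simp only [cf]; split_ifs with h <;> [exact h; exact one_pos]
  have hcg : 0 < cg := by simp only [cg]; split_ifs with h <;> [exact h; exact one_pos]
  have hfc : ∀ {q : EuclideanSpace ℝ (Fin p)} {f : ∀ i, EuclideanSpace ℝ (Fin (m i)) → ℝ}
      {g : ∀ j, EuclideanSpace ℝ (Fin (n j)) → EReal}, StandingAssumptions E F q f g Lf →
      StrongConvexityPattern f g I J mf mg →
      StrongConvexAlong cf (maskL m I) (smoothPart f) := by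
    intro q f g h1 h2
    refine strongConvexAlong_smoothPart h1.convex_f fun i hi => ?_
    obtain ⟨hpos, hi⟩ := h2.modulus_f i hi
    simpa only [cf, if_pos hpos] using hi
  have hgc : ∀ {q : EuclideanSpace ℝ (Fin p)} {f : ∀ i, EuclideanSpace ℝ (Fin (m i)) → ℝ}
      {g : ∀ j, EuclideanSpace ℝ (Fin (n j)) → EReal}, StandingAssumptions E F q f g Lf →
      StrongConvexityPattern f g I J mf mg →
      ClosedStrongConvexAlong cg (maskL n J) (nonsmoothPart g) := by
    intro q f g h1 h2
    refine closedStrongConvexAlong_nonsmoothPart h1.closed_convex_g fun j hj => ?_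
    obtain ⟨hpos, hj⟩ := h2.modulus_g j hj
    simpa only [cg, if_pos hpos] using hj
  refine ⟨?_, fun mxz _ α hα _ => ?_⟩
  · obtain ⟨c, hc, h⟩ := exists_primalStrongConvex (μ := μ) hT hinj hμ hcf hcg
    exact ⟨c, hc, fun q f g h1 h2 => h q f g (hfc h1 h2) (hgc h1 h2)⟩
  · obtain ⟨κ, hκ, hdiss⟩ := exists_isDissipationBound _ _ hT _ _ hinj hμ hcf hcg
    obtain ⟨M, ρ, hM, hρ, hbound⟩ := exists_isExponentialBound (Matrix.toEuclideanLin E)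
      (Matrix.toEuclideanLin F) hμ hα Lf.coe_nonneg hκ
    refine ⟨M, ρ, hM, hρ, fun q f g h1 h2 _ => ?_⟩
    have hf : ∀ x, HasGradientAt (smoothPart f) (gradient (smoothPart f) x) x := fun x =>
      (differentiable_smoothPart h1.differentiable_f x).hasGradientAt
    have hL : ∀ x u, ‖gradient (smoothPart f) x - gradient (smoothPart f) u‖ ≤ Lf * ‖x - u‖ :=
      fun x u => h1.lipschitz_grad_f.norm_sub_le x u
    obtain ⟨x₁, z₁, hz₁, hres⟩ := h1.qualification
    obtain ⟨x₀, z₀, y₀, lam₀, hKKT⟩ := exists_isKKT hμ hf (hfc h1 h2) (hgc h1 h2) hcf hcg hinj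
      hrange' (sub_eq_zero.mp hres) (intrinsicInterior_subset hz₁)
    have heq : ∀ ψ : State m n p, ψ ∈ equilibria E F q f g μ α ↔ ψ.x = x₀ ∧ ψ.z = z₀ ∧
        ψ.y = y₀ ∧ LinearMap.adjoint (Matrix.toEuclideanLin E) (ψ.lam - lam₀) = 0 := fun ψ =>
      (mem_equilibria_iff hμ hα hf ((hgc h1 h2).hasGradientAt_moreau hcg.le hμ) ψ).trans
        (hKKT.iff hμ hf (hfc h1 h2) (hgc h1 h2) hT hcf hcg hinj hrange' ψ.x ψ.z ψ.y ψ.lam)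
    exact ⟨exists_affineSubspace_eq heq, fun t₀ ψ hψ => exists_limit_of_isSolution hμ hα hρ hcg.le
      hbound hdiss hrange' hf (hfc h1 h2) (hgc h1 h2) hL heq hψ⟩
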